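/- Let $n\ge 1$, let $\alpha=(\alpha_1,\dots,\alpha_n)\in\mathbb R^n$ with $\alpha_j>-1$ for every $j$, and let $1<p<\infty$ and $pq=p+q$. On the unit polydisc $\mathbb D^n\subset\mathbb C^n$ consider the measure $$dv_\alpha(z)=\prod_{j=1}^n(\alpha_j+1)(1-|z_j|^2)^{\alpha_j}\,d\nu(z_j),$$ where $\nu$ is the area measure on the unit disc $\mathbb D$ normalized by $\nu(\mathbb D)=1$. Let $\|\cdot\|_{r,\alpha}$ be the norm of $L^r(\mathbb D^n,dv_\alpha)$, and let $A^r_\alpha(\mathbb D^n)$ be the space of holomorphic functions on $\mathbb D^n$ that belong to $L^r(\mathbb D^n,dv_\alpha)$. Put $$K^\alpha(z,w)=\prod_{j=1}^n\frac1{(1-z_j\overline{w_j})^{\alpha_j+2}},\qquad P_\alpha\varphi(w)=\int_{\mathbb D^n}\varphi(z)K^\alpha(w,z)\,dv_\alpha(z),\qquad k^\alpha_w=\frac{K^\alpha(\cdot,w)}{\|K^\alpha(\cdot,w)\|_{2,\alpha}},$$ and let $T_uh=P_\alpha(uh)$ be the Toeplitz operator with symbol $u$. For $f\in A^p_\alpha(\mathbb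 D^n)$ and $g\in A^q_\alpha(\mathbb D^n)$ the product $T_fT_{\overline g}$ is densely defined on $A^p_\alpha(\mathbb D^n)$, with domain the bounded holomorphic functions on $\mathbb D^n$. It is called bounded on $A^p_\alpha(\mathbb D^n)$ if there is a finite constant $M\ge 0$ such that $T_fT_{\overline g}h\in A^p_\alpha(\mathbb D^n)$ and $\|T_fT_{\overline g}h\|_{p,\alpha}\le M\|h\|_{p,\alpha}$ for every bounded holomorphic $h$, and $\|T_fT_{\overline g}\|$ is the least such $M$. There is a finite constant $C$, depending only on $n$, $\alpha$ and $p$, such that for all $f\in A^p_\alpha(\mathbb D^n)$ and $g\in A^q_\alpha(\mathbb D^n)$ for which $T_fT_{\overline g}$ is bounded on $A^p_\alpha(\mathbb D^n)$, $$[f,g]_{p,\alpha}:=\sup_{w\in\mathbb D^n}\|fk^\alpha_w\|_{p,\alpha}\,\|gk^\alpha_w\|_{q,\alpha}<\infty\qquad\text{and}\qquad [f,g]_{p,\alpha}\le C\,\|T_fT_{\overline g}\|.$$ -/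

import Mathlib

open MeasureTheory
open scoped ENNReal NNReal ComplexConjugate

noncomputable section

namespace PolydiscBergman

/-- The unit polydisc of `ℂⁿ`. -/
def polydisc (n : ℕ) : Set (Fin n → ℂ) := {z | ∀ j, ‖z j‖ < 1}

/-- The area measure of the unit disc of `ℂ`, normalized so that the disc has measure one. -/
def discArea : Measure ℂ :=
  ENNReal.ofReal Real.pi⁻¹ • volume.restrict (Metric.ball (0 : ℂ) 1)

/-- The one-variable weighted measure `(a + 1) (1 - |z|²)ᵃ dν(z)` on the unit disc. -/
def discMeasure (a : ℝ) : Measure ℂ :=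
  discArea.withDensity fun z => ENNReal.ofReal ((a + 1) * (1 - ‖z‖ ^ 2) ^ a)

/-- The measure `dv_α(z) = ∏ⱼ (αⱼ + 1) (1 - |zⱼ|²)^{αⱼ} dν(zⱼ)`, carried by the polydisc. -/
def weightedMeasure {n : ℕ} (α : Fin n → ℝ) : Measure (Fin n → ℂ) :=
  Measure.pi fun j => discMeasure (α j)

/-- The norm `‖f‖_{p,α}` of `Lᵖ(𝔻ⁿ, dv_α)`, with the value `∞` allowed. -/
def bergmanNorm {n : ℕ} (α : Fin n → ℝ) (p : ℝ) (f : (Fin n → ℂ) → ℂ) : ℝ≥0∞ :=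
  eLpNorm f (ENNReal.ofReal p) (weightedMeasure α)

/-- `f` belongs to the weighted Bergman space `A^p_α(𝔻ⁿ) = H(𝔻ⁿ) ∩ Lᵖ(𝔻ⁿ, dv_α)`.
Values of `f` outside the polydisc play no role. -/
def MemBergman {n : ℕ} (α : Fin n → ℝ) (p : ℝ) (f : (Fin n → ℂ) → ℂ) : Prop :=
  DifferentiableOn ℂ f (polydisc n) ∧ MemLp f (ENNReal.ofReal p) (weightedMeasure α)

/-- `h` is a bounded holomorphic function on the polydisc. -/
def IsBoundedHolomorphic {n : ℕ} (h : (Fin n → ℂ) → ℂ) : Prop :=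
  DifferentiableOn ℂ h (polydisc n) ∧ ∃ M : ℝ, ∀ z ∈ polydisc n, ‖h z‖ ≤ M

/-- The reproducing kernel `K^α(z, w) = ∏ⱼ (1 - zⱼ w̄ⱼ)^{-(αⱼ + 2)}`; principal powers are meant,
since every `1 - zⱼ w̄ⱼ` has positive real part. -/
def kernel {n : ℕ} (α : Fin n → ℝ) (z w : Fin n → ℂ) : ℂ :=
  ∏ j, 1 / (1 - z j * conj (w j)) ^ ((α j + 2 : ℝ) : ℂ)

/-- The normalized reproducing kernel `k_w^α = K_w^α / ‖K_w^α‖_{2,α}`, where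
`K_w^α(z) = K^α(z, w)`. -/
def normalizedKernel {n : ℕ} (α : Fin n → ℝ) (w z : Fin n → ℂ) : ℂ :=
  kernel α z w / ((bergmanNorm α 2 fun u => kernel α u w).toReal : ℂ)

/-- The Bergman projection `P_α φ(w) = ∫ φ(z) K^α(w, z) dv_α(z)`. -/
def bergmanProjection {n : ℕ} (α : Fin n → ℝ) (φ : (Fin n → ℂ) → ℂ) (w : Fin n → ℂ) : ℂ :=
  ∫ z, φ z * kernel α w z ∂(weightedMeasure α)

/-- The Toeplitz operator `T_u h = P_α(u h)`. -/
def toeplitz {n : ℕ} (α : Fin n → ℝ) (u h : (Fin n → ℂ) → ℂ) : (Fin n → ℂ) → ℂ :=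
  bergmanProjection α fun z => u z * h z

/-- The Toeplitz product `T_f T_{ḡ}`. -/
def toeplitzProduct {n : ℕ} (α : Fin n → ℝ) (f g h : (Fin n → ℂ) → ℂ) : (Fin n → ℂ) → ℂ :=
  toeplitz α f (toeplitz α (fun z => conj (g z)) h)

/-- `C` bounds the operator `T`, densely defined on `A^p_α(𝔻ⁿ)` with domain the bounded
holomorphic functions: `T` takes its values in `A^p_α(𝔻ⁿ)` and `‖T h‖_{p,α} ≤ C ‖h‖_{p,α}`. -/
def IsOperatorBound {n : ℕ} (α : Fin n → ℝ) (p : ℝ)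
    (T : ((Fin n → ℂ) → ℂ) → (Fin n → ℂ) → ℂ) (C : ℝ≥0) : Prop :=
  ∀ h, IsBoundedHolomorphic h →
    MemBergman α p (T h) ∧ bergmanNorm α p (T h) ≤ C * bergmanNorm α p h

/-- The densely defined operator `T` is bounded on `A^p_α(𝔻ⁿ)`. -/
def IsBoundedOperator {n : ℕ} (α : Fin n → ℝ) (p : ℝ)
    (T : ((Fin n → ℂ) → ℂ) → (Fin n → ℂ) → ℂ) : Prop :=
  ∃ C : ℝ≥0, IsOperatorBound α p T C

/-- The operator norm on `A^p_α(𝔻ⁿ)`: the least bound of `T`. -/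
def operatorNorm {n : ℕ} (α : Fin n → ℝ) (p : ℝ)
    (T : ((Fin n → ℂ) → ℂ) → (Fin n → ℂ) → ℂ) : ℝ≥0 :=
  sInf {C : ℝ≥0 | IsOperatorBound α p T C}

/-- The Sarason quantity
`[f, g]_{p,α} = sup_{w ∈ 𝔻ⁿ} ‖f k_w^α‖_{p,α} ‖g k_w^α‖_{q,α}`, with the value `∞` allowed. -/
def sarason {n : ℕ} (α : Fin n → ℝ) (p q : ℝ) (f g : (Fin n → ℂ) → ℂ) : ℝ≥0∞ :=
  ⨆ w ∈ polydisc n,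
    bergmanNorm α p (fun z => f z * normalizedKernel α w z) *
      bergmanNorm α q (fun z => g z * normalizedKernel α w z)

end PolydiscBergman

end

noncomputable section

namespace PolydiscBergman

/-! ### Powers of complex numbers with positive real part -/

/-! Let φ_w be the Möbius involution that interchanges 0 and w in each coordinate. Raising the
identity (1 - φ_w(z) conj φ_w(v)) (1 - z w̄) (1 - w v̄) = (1 - |w|²) (1 - z v̄) to the power α + 2,
coordinate by coordinate, gives k_w(z) conj k_w(v) = ∏ⱼ (1 - φ_w(z)ⱼ conj φ_w(v)ⱼ)^{αⱼ+2} · K(z, v).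
Since αⱼ + 2 > 0, the binomial series of these powers has absolutely summable coefficients c_k, and
their sum does not depend on w (`hasSum_multiCoeff`).

Multiply by f(z) conj g(v) ψ(v) and integrate in v. The rank-one operator ψ ↦ f k_w ∫ ψ conj(g k_w)
becomes Σ c_k φ_w^k · f P(ḡ θ_k), with θ_k = conj(φ_w^k) ψ. For an antiholomorphic symbol the
projection can be dropped, T_ḡ P θ = P(ḡ θ), so each term is c_k φ_w^k T_f T_ḡ(P θ_k). As |φ_w^k| ≤
1 and P is bounded on L^p, the rank-one operator has norm at most (Σ |c_k|) ‖P‖ ‖T_f T_ḡ‖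
(`exists_bergmanNorm_mul_integral_le`). By duality this norm is ‖f k_w‖_p ‖g k_w‖_q.

Two analytic points remain. Only bounded holomorphic functions may be fed to T_f T_ḡ, so ψ is
supported in a closed ball of radius r < 1, where P θ_k is bounded and holomorphic; Fatou's lemma
then lets r tend to 1. The L^p bound for P comes from the Schur test with powers of 1 - |zⱼ|²
(`exists_lintegral_kernel_rpow_le`), which rests on Forelli–Rudin estimates obtained by a Möbius
substitution. -/

theorem cpow_mul_mul_eq_of_re_pos {x y z d : ℂ} {t : ℝ} (hx : 0 < x.re) (hy : 0 < y.re)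
    (hz : 0 < z.re) (hd : 0 < d.re) (ht : 0 < t) (h : x * y * z = t * d) (b : ℂ) :
    x ^ b * y ^ b * z ^ b = (t : ℂ) ^ b * d ^ b := by
  have ne : ∀ {u : ℂ}, 0 < u.re → u ≠ 0 := by
    rintro u hu rfl
    simp at hu
  have im : ∀ {u : ℂ}, 0 < u.re → |(Complex.log u).im| < Real.pi / 2 := fun hu => by
    rw [Complex.log_im]
    exact Complex.abs_arg_lt_pi_div_two_iff.2 (Or.inl hu)
  have ht' : (t : ℂ) ≠ 0 := by exact_mod_cast ht.ne'
  have hlog : Complex.log x + Complex.log y + Complex.log z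
      = Complex.log t + Complex.log d := by
    have he : Complex.exp (Complex.log x + Complex.log y + Complex.log z)
        = Complex.exp (Complex.log t + Complex.log d) := by
      rw [Complex.exp_add, Complex.exp_add, Complex.exp_add, Complex.exp_log (ne hx),
        Complex.exp_log (ne hy), Complex.exp_log (ne hz), Complex.exp_log (ne hd),
        Complex.exp_log ht', h]
    obtain ⟨m, hm⟩ := Complex.exp_eq_exp_iff_exists_int.1 he
    have him := congrArg Complex.im hm
    have hti : (Complex.log t).im = 0 := by
      rw [Complex.log_im, Complex.arg_ofReal_of_nonneg ht.le]
    have h2 : ((m : ℂ) * (2 * Real.pi * Complex.I)).im = m * (2 * Real.pi) := by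
      simp
    rw [Complex.add_im, Complex.add_im, Complex.add_im, Complex.add_im, hti, h2] at him
    have h1 := abs_lt.1 (im hx)
    have h3 := abs_lt.1 (im hy)
    have h4 := abs_lt.1 (im hz)
    have h5 := abs_lt.1 (im hd)
    have hpi := Real.pi_pos
    -- Four arguments, each of absolute value below π/2, cannot add up to 2π in absolute value, so
    -- no branch jump occurs.
    have hm0 : m = 0 := by
      have hlt : (m : ℝ) < 1 := by
        by_contra hc
        have : 1 * (2 * Real.pi) ≤ (m : ℝ) * (2 * Real.pi) :=
          mul_le_mul_of_nonneg_right (not_lt.1 hc) (by positivity)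
        linarith
      have hgt : (-1 : ℝ) < m := by
        by_contra hc
        have : (m : ℝ) * (2 * Real.pi) ≤ -1 * (2 * Real.pi) :=
          mul_le_mul_of_nonneg_right (not_lt.1 hc) (by positivity)
        linarith
      have : m < 1 := by exact_mod_cast hlt
      have : -1 < m := by exact_mod_cast hgt
      omega
    rw [hm, hm0]
    simp
  rw [Complex.cpow_def_of_ne_zero (ne hx), Complex.cpow_def_of_ne_zero (ne hy),
    Complex.cpow_def_of_ne_zero (ne hz), Complex.cpow_def_of_ne_zero (ne hd),
    Complex.cpow_def_of_ne_zero ht', ← Complex.exp_add, ← Complex.exp_add, ← Complex.exp_add,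
    ← add_mul, ← add_mul, ← add_mul, hlog]

theorem re_one_sub_pos {u : ℂ} (hu : ‖u‖ < 1) : 0 < (1 - u).re := by
  have := Complex.re_le_norm u
  simp
  linarith

theorem norm_mul_conj_lt_one {z w : ℂ} (hz : ‖z‖ < 1) (hw : ‖w‖ < 1) : ‖z * conj w‖ < 1 := by
  rw [norm_mul, Complex.norm_conj]
  nlinarith [norm_nonneg z, norm_nonneg w]

theorem conj_cpow_of_re_pos {u : ℂ} (hu : 0 < u.re) (b : ℝ) :
    conj u ^ (b : ℂ) = conj (u ^ (b : ℂ)) := by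
  rw [Complex.conj_cpow _ _ (fun h => ?_), Complex.conj_ofReal]
  have := Complex.abs_arg_lt_pi_div_two_iff.2 (Or.inl hu)
  rw [h, abs_of_pos Real.pi_pos] at this
  linarith [Real.pi_pos]

theorem norm_cpow_ofReal {u : ℂ} (hu : 0 < u.re) (b : ℝ) : ‖u ^ (b : ℂ)‖ = ‖u‖ ^ b := by
  rw [Complex.norm_cpow_of_ne_zero (by rintro rfl; simp at hu)]
  simp

/-! ### Möbius involutions of the disc -/

/-- The Möbius involution of the unit disc that interchanges `0` and `w`. -/
def moebius (w z : ℂ) : ℂ := (w - z) / (1 - conj w * z)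

theorem one_sub_conj_mul_ne_zero {w z : ℂ} (hw : ‖w‖ < 1) (hz : ‖z‖ < 1) :
    1 - conj w * z ≠ 0 := by
  have := re_one_sub_pos (norm_mul_conj_lt_one hz hw)
  rw [mul_comm]
  intro h
  rw [h] at this
  simp at this

theorem one_sub_mul_conj_ne_zero {w z : ℂ} (hw : ‖w‖ < 1) (hz : ‖z‖ < 1) :
    1 - z * conj w ≠ 0 := by
  rw [mul_comm]
  exact one_sub_conj_mul_ne_zero hw hz

/-- The algebraic identity behind the whole proof. It is kept free of division so that it matches
the three-factor rule for principal powers. -/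
theorem one_sub_moebius_mul_conj {w z u : ℂ} (hw : ‖w‖ < 1) (hz : ‖z‖ < 1) (hu : ‖u‖ < 1) :
    (1 - moebius w z * conj (moebius w u)) * (1 - z * conj w) * (1 - w * conj u)
      = ((1 - ‖w‖ ^ 2 : ℝ) : ℂ) * (1 - z * conj u) := by
  have h1 := one_sub_mul_conj_ne_zero hw hz
  have h2 : 1 - w * conj u ≠ 0 := one_sub_mul_conj_ne_zero hu hw
  have hn : ((1 - ‖w‖ ^ 2 : ℝ) : ℂ) = 1 - w * conj w := by
    rw [Complex.mul_conj, Complex.normSq_eq_norm_sq]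
    push_cast
    ring
  rw [hn]
  simp only [moebius, map_div₀, map_sub, map_mul, map_one, Complex.conj_conj, mul_comm (conj w) z]
  field_simp
  ring

theorem one_sub_norm_moebius_sq {w z : ℂ} (hw : ‖w‖ < 1) (hz : ‖z‖ < 1) :
    1 - ‖moebius w z‖ ^ 2 = (1 - ‖w‖ ^ 2) * (1 - ‖z‖ ^ 2) / ‖1 - conj w * z‖ ^ 2 := by
  have h := one_sub_moebius_mul_conj hw hz hz
  have h1 : ‖1 - conj w * z‖ ^ 2 ≠ 0 := by
    simpa using one_sub_conj_mul_ne_zero hw hz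
  rw [eq_div_iff h1]
  have e : ∀ x : ℂ, x * conj x = ((‖x‖ ^ 2 : ℝ) : ℂ) := fun x => by
    rw [Complex.mul_conj, Complex.normSq_eq_norm_sq]
  have e2 : (1 - z * conj w) * (1 - w * conj z) = ((‖1 - conj w * z‖ ^ 2 : ℝ) : ℂ) := by
    rw [← e]
    simp only [map_sub, map_mul, map_one, Complex.conj_conj]
    ring
  rw [mul_assoc, e2, e, e] at h
  exact_mod_cast h

theorem norm_moebius_lt_one {w z : ℂ} (hw : ‖w‖ < 1) (hz : ‖z‖ < 1) : ‖moebius w z‖ < 1 := by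
  have h := one_sub_norm_moebius_sq hw hz
  have h1 : 0 < ‖1 - conj w * z‖ := norm_pos_iff.2 (one_sub_conj_mul_ne_zero hw hz)
  have h2 : 0 < 1 - ‖w‖ ^ 2 := by nlinarith [norm_nonneg w]
  have h3 : 0 < 1 - ‖z‖ ^ 2 := by nlinarith [norm_nonneg z]
  have : 0 < 1 - ‖moebius w z‖ ^ 2 := by
    rw [h]
    positivity
  nlinarith [norm_nonneg (moebius w z)]

theorem one_sub_conj_mul_moebius {w z : ℂ} (hw : ‖w‖ < 1) (hz : ‖z‖ < 1) :
    1 - conj w * moebius w z = ((1 - ‖w‖ ^ 2 : ℝ) : ℂ) / (1 - conj w * z) := by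
  have h1 := one_sub_conj_mul_ne_zero hw hz
  have hn : ((1 - ‖w‖ ^ 2 : ℝ) : ℂ) = 1 - w * conj w := by
    rw [Complex.mul_conj, Complex.normSq_eq_norm_sq]
    push_cast
    ring
  rw [hn, moebius]
  field_simp
  ring

theorem one_sub_norm_sq_pos {w : ℂ} (hw : ‖w‖ < 1) : 0 < 1 - ‖w‖ ^ 2 := by
  nlinarith [norm_nonneg w]

theorem moebius_moebius {w z : ℂ} (hw : ‖w‖ < 1) (hz : ‖z‖ < 1) :
    moebius w (moebius w z) = z := by
  have h1 := one_sub_conj_mul_ne_zero hw hz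
  have hn : ((1 - ‖w‖ ^ 2 : ℝ) : ℂ) = 1 - w * conj w := by
    rw [Complex.mul_conj, Complex.normSq_eq_norm_sq]
    push_cast
    ring
  have h2 : ((1 - ‖w‖ ^ 2 : ℝ) : ℂ) ≠ 0 := by exact_mod_cast (one_sub_norm_sq_pos hw).ne'
  rw [moebius, one_sub_conj_mul_moebius hw hz, div_div_eq_mul_div, div_eq_iff h2, hn, moebius,
    sub_mul, div_mul_cancel₀ _ h1]
  ring

theorem moebius_zero_right (w : ℂ) : moebius w 0 = w := by simp [moebius]

theorem hasDerivAt_moebius {w z : ℂ} (hw : ‖w‖ < 1) (hz : ‖z‖ < 1) :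
    HasDerivAt (moebius w) (-((1 - ‖w‖ ^ 2 : ℝ) : ℂ) / (1 - conj w * z) ^ 2) z := by
  have h1 := one_sub_conj_mul_ne_zero hw hz
  have h := (((hasDerivAt_id z).const_sub w).div
    (((hasDerivAt_id z).const_mul (conj w)).const_sub 1) h1)
  refine h.congr_deriv ?_
  have hn : ((1 - ‖w‖ ^ 2 : ℝ) : ℂ) = 1 - w * conj w := by
    rw [Complex.mul_conj, Complex.normSq_eq_norm_sq]
    push_cast
    ring
  rw [hn]
  congr 1
  simp only [id]
  ring

theorem measurable_moebius (w : ℂ) : Measurable (moebius w) := by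
  unfold moebius
  fun_prop

theorem image_moebius_ball {w : ℂ} (hw : ‖w‖ < 1) :
    moebius w '' Metric.ball 0 1 = Metric.ball 0 1 := by
  ext z
  simp only [Set.mem_image, mem_ball_zero_iff]
  constructor
  · rintro ⟨x, hx, rfl⟩
    exact norm_moebius_lt_one hw hx
  · intro hz
    exact ⟨moebius w z, norm_moebius_lt_one hw hz, moebius_moebius hw hz⟩

theorem injOn_moebius {w : ℂ} (hw : ‖w‖ < 1) : Set.InjOn (moebius w) (Metric.ball 0 1) := by
  intro x hx y hy h
  rw [mem_ball_zero_iff] at hx hy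
  rw [← moebius_moebius hw hx, h, moebius_moebius hw hy]

theorem abs_det_restrictScalars_smulRight (c : ℂ) :
    |(((ContinuousLinearMap.toSpanSingleton ℂ c).restrictScalars ℝ : ℂ →L[ℝ] ℂ)).det| = ‖c‖ ^ 2 := by
  have : ((((ContinuousLinearMap.toSpanSingleton ℂ c).restrictScalars ℝ : ℂ →L[ℝ] ℂ)) : ℂ →ₗ[ℝ] ℂ)
      = ((LinearMap.toSpanSingleton ℂ ℂ c).restrictScalars ℝ) := rfl
  rw [ContinuousLinearMap.det, this, LinearMap.det_restrictScalars]
  simp [Algebra.norm_complex_eq, Complex.normSq_eq_norm_sq]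

/-- The involution maps the disc bijectively onto itself, and the real Jacobian of a holomorphic map
is the squared modulus of its derivative. No measurability of `F` is needed. -/
theorem lintegral_ball_comp_moebius {w : ℂ} (hw : ‖w‖ < 1) (F : ℂ → ℝ≥0∞) :
    ∫⁻ z in Metric.ball (0 : ℂ) 1, F z =
      ∫⁻ z in Metric.ball (0 : ℂ) 1,
        ENNReal.ofReal (((1 - ‖w‖ ^ 2) / ‖1 - conj w * z‖ ^ 2) ^ 2) * F (moebius w z) := by
  conv_lhs => rw [← image_moebius_ball hw]
  rw [lintegral_image_eq_lintegral_abs_det_fderiv_mul volume measurableSet_ball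
    (f' := fun z => (ContinuousLinearMap.toSpanSingleton ℂ
      (-((1 - ‖w‖ ^ 2 : ℝ) : ℂ) / (1 - conj w * z) ^ 2)).restrictScalars ℝ) ?_ (injOn_moebius hw)]
  · refine setLIntegral_congr_fun measurableSet_ball fun z _ => ?_
    rw [abs_det_restrictScalars_smulRight, norm_div, norm_neg, norm_pow, Complex.norm_real,
      Real.norm_of_nonneg (one_sub_norm_sq_pos hw).le]
  · intro z hz
    rw [mem_ball_zero_iff] at hz
    exact ((hasDerivAt_moebius hw hz).hasFDerivAt.restrictScalars ℝ).hasFDerivWithinAt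

/-! ### The weighted measure of the disc -/

/-- The density of `discMeasure a` with respect to Lebesgue measure on the disc. -/
def discDensity (a : ℝ) (z : ℂ) : ℝ := Real.pi⁻¹ * ((a + 1) * (1 - ‖z‖ ^ 2) ^ a)

theorem measurable_discDensity (a : ℝ) : Measurable (discDensity a) := by
  unfold discDensity
  fun_prop

theorem discDensity_nonneg {a : ℝ} (ha : -1 < a) {z : ℂ} (hz : ‖z‖ < 1) : 0 ≤ discDensity a z := by
  have := one_sub_norm_sq_pos hz
  have := Real.pi_pos
  have : 0 < a + 1 := by linarith
  unfold discDensity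
  positivity

theorem discMeasure_eq (a : ℝ) :
    discMeasure a = (volume.restrict (Metric.ball (0 : ℂ) 1)).withDensity
      fun z => ENNReal.ofReal (discDensity a z) := by
  have hm : Measurable fun z : ℂ => ENNReal.ofReal ((a + 1) * (1 - ‖z‖ ^ 2) ^ a) := by fun_prop
  rw [discMeasure, discArea, withDensity_smul_measure, ← withDensity_smul _ hm]
  congr 1
  ext z
  rw [Pi.smul_apply, smul_eq_mul, discDensity,
    ENNReal.ofReal_mul (inv_nonneg.2 Real.pi_pos.le)]

theorem lintegral_discMeasure (a : ℝ) (F : ℂ → ℝ≥0∞) :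
    ∫⁻ z, F z ∂discMeasure a =
      ∫⁻ z in Metric.ball 0 1, ENNReal.ofReal (discDensity a z) * F z := by
  rw [discMeasure_eq, lintegral_withDensity_eq_lintegral_mul_non_measurable₀]
  · rfl
  · exact (measurable_discDensity a).ennreal_ofReal.aemeasurable
  · exact Filter.Eventually.of_forall fun _ => ENNReal.ofReal_lt_top

theorem ae_discMeasure_norm_lt_one (a : ℝ) : ∀ᵐ z ∂discMeasure a, ‖z‖ < 1 := by
  rw [discMeasure_eq]
  refine (withDensity_absolutelyContinuous _ _).ae_le ?_
  filter_upwards [ae_restrict_mem measurableSet_ball] with z hz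
  exact mem_ball_zero_iff.1 hz

/-- The antiderivative -(1 - r²)^{a+1} / (2(a+1)) stays continuous at r = 1 because a + 1 > 0, even
when the integrand blows up there. The value normalizes the measure; the integrability returns in
the Forelli–Rudin estimate with another exponent. -/
theorem integral_one_sub_sq_rpow {a : ℝ} (ha : -1 < a) :
    ∫ r in (0 : ℝ)..1, r * (1 - r ^ 2) ^ a = 1 / (2 * (a + 1)) ∧
      IntervalIntegrable (fun r : ℝ => r * (1 - r ^ 2) ^ a) volume 0 1 := by
  have ha1 : 0 < a + 1 := by linarith
  have hcont : ContinuousOn (fun r : ℝ => -(1 - r ^ 2) ^ (a + 1) / (2 * (a + 1)))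
      (Set.Icc 0 1) := by
    refine Continuous.continuousOn ?_
    have : Continuous fun r : ℝ => (1 - r ^ 2) ^ (a + 1) :=
      (by fun_prop : Continuous fun r : ℝ => 1 - r ^ 2).rpow_const fun _ => Or.inr ha1.le
    fun_prop
  have hderiv : ∀ r ∈ Set.Ioo (0 : ℝ) 1,
      HasDerivAt (fun r : ℝ => -(1 - r ^ 2) ^ (a + 1) / (2 * (a + 1)))
        (r * (1 - r ^ 2) ^ a) r := by
    intro r hr
    have hpos : 0 < 1 - r ^ 2 := by nlinarith [hr.1, hr.2]
    have h := ((((hasDerivAt_id r).pow 2).const_sub 1).rpow_const (p := a + 1)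
      (Or.inl hpos.ne')).neg.div_const (2 * (a + 1))
    refine h.congr_deriv ?_
    simp only [id, Nat.cast_ofNat, Nat.add_one_sub_one, pow_one, mul_one, add_sub_cancel_right]
    field_simp
    rfl
  have hint : IntervalIntegrable (fun r : ℝ => r * (1 - r ^ 2) ^ a) volume 0 1 := by
    refine intervalIntegral.intervalIntegrable_deriv_of_nonneg (g := fun r : ℝ =>
      -(1 - r ^ 2) ^ (a + 1) / (2 * (a + 1))) (by simpa using hcont) (by simpa using hderiv) ?_
    intro r hr
    simp only [zero_le_one, inf_of_le_left, sup_of_le_right, Set.mem_Ioo] at hr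
    have hpos : 0 < 1 - r ^ 2 := by nlinarith [hr.1, hr.2]
    have := hr.1
    positivity
  refine ⟨?_, hint⟩
  rw [intervalIntegral.integral_eq_sub_of_hasDerivAt_of_le zero_le_one hcont hderiv hint]
  simp [Real.zero_rpow ha1.ne']
  field_simp

theorem lintegral_discMeasure_one {a : ℝ} (ha : -1 < a) : discMeasure a Set.univ = 1 := by
  rw [← lintegral_one, lintegral_discMeasure]
  simp only [mul_one]
  set D : ℝ → ℝ := fun r => Real.pi⁻¹ * ((a + 1) * (1 - r ^ 2) ^ a) with hD
  obtain ⟨hval, hint⟩ := integral_one_sub_sq_rpow ha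
  have hint' : IntegrableOn (fun y : ℝ => y ^ (Module.finrank ℝ ℂ - 1) • D y) (Set.Ioo 0 1) := by
    rw [intervalIntegrable_iff_integrableOn_Ioo_of_le zero_le_one] at hint
    refine (hint.const_mul (Real.pi⁻¹ * (a + 1))).congr ?_
    refine Filter.Eventually.of_forall fun y => ?_
    simp [hD, Complex.finrank_real_complex]
    ring
  have h1 : IntegrableOn (fun z : ℂ => D ‖z‖) (Metric.ball 0 1) :=
    (integrableOn_fun_norm_addHaar volume).2 hint'
  have h2 : ∫ z in Metric.ball (0 : ℂ) 1, D ‖z‖ = 1 := by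
    have : ∫ z in Metric.ball (0 : ℂ) 1, D ‖z‖ = ∫ z : ℂ, (Set.Iio (1 : ℝ)).indicator D ‖z‖ := by
      rw [← integral_indicator measurableSet_ball]
      congr 1
      ext z
      simp [Set.indicator]
    rw [this, integral_fun_norm_addHaar]
    have h3 : ∫ y in Set.Ioi (0 : ℝ), y ^ (Module.finrank ℝ ℂ - 1) •
        (Set.Iio (1 : ℝ)).indicator D y = Real.pi⁻¹ * (a + 1) * (1 / (2 * (a + 1))) := by
      rw [← hval, intervalIntegral.integral_of_le zero_le_one, ← integral_Ioc_eq_integral_Ioo.symm,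
        ← integral_const_mul, ← integral_indicator measurableSet_Ioi,
        ← integral_indicator measurableSet_Ioo]
      congr 1
      ext y
      simp only [Set.indicator, Set.mem_Ioi, Set.mem_Iio, Set.mem_Ioo, hD,
        Complex.finrank_real_complex]
      split_ifs <;> simp_all; ring
    have ha1 : a + 1 ≠ 0 := by linarith
    rw [h3, Measure.real, Complex.volume_ball, Complex.finrank_real_complex]
    simp
    have := Real.pi_ne_zero
    field_simp
  have h4 := ofReal_integral_eq_lintegral_ofReal h1 ?_
  · rw [h2, ENNReal.ofReal_one] at h4
    exact h4.symm
  · filter_upwards [ae_restrict_mem measurableSet_ball] with z hz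
    exact discDensity_nonneg ha (mem_ball_zero_iff.1 hz)

theorem isProbabilityMeasure_discMeasure {a : ℝ} (ha : -1 < a) :
    IsProbabilityMeasure (discMeasure a) :=
  ⟨lintegral_discMeasure_one ha⟩

/-- The weight in the change of variables `z ↦ moebius w z` for `discMeasure a`. -/
def moebiusWeight (a : ℝ) (w z : ℂ) : ℝ :=
  (1 - ‖w‖ ^ 2) ^ (a + 2) / (‖1 - conj w * z‖ ^ (a + 2)) ^ 2

/-- The Jacobian contributes exponent 2 and the density exponent a; together they give the exponent
a + 2 of the kernel. -/
theorem discDensity_moebius {a : ℝ} {w z : ℂ} (hw : ‖w‖ < 1) (hz : ‖z‖ < 1) :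
    ((1 - ‖w‖ ^ 2) / ‖1 - conj w * z‖ ^ 2) ^ 2 * discDensity a (moebius w z) =
      discDensity a z * moebiusWeight a w z := by
  have h1 : 0 < ‖1 - conj w * z‖ := norm_pos_iff.2 (one_sub_conj_mul_ne_zero hw hz)
  have h2 := one_sub_norm_sq_pos hw
  have h3 := one_sub_norm_sq_pos hz
  rw [discDensity, discDensity, moebiusWeight, one_sub_norm_moebius_sq hw hz,
    Real.div_rpow (by positivity) (by positivity), Real.mul_rpow h2.le h3.le,
    Real.rpow_add h2, Real.rpow_add h1, Real.rpow_two, Real.rpow_two,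
    ← Real.rpow_natCast_mul h1.le 2, mul_comm _ a, Real.rpow_mul_natCast h1.le]
  field_simp

theorem lintegral_discMeasure_comp_moebius (a : ℝ) {w : ℂ} (hw : ‖w‖ < 1) (F : ℂ → ℝ≥0∞) :
    ∫⁻ z, F z ∂discMeasure a =
      ∫⁻ z, ENNReal.ofReal (moebiusWeight a w z) * F (moebius w z) ∂discMeasure a := by
  rw [lintegral_discMeasure, lintegral_discMeasure, lintegral_ball_comp_moebius hw]
  refine setLIntegral_congr_fun measurableSet_ball fun z hz => ?_
  have hz' := mem_ball_zero_iff.1 hz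
  rw [← mul_assoc, ← mul_assoc, ← ENNReal.ofReal_mul (by positivity), discDensity_moebius hw hz',
    ENNReal.ofReal_mul' ?_]
  have := one_sub_norm_sq_pos hw
  unfold moebiusWeight
  positivity

theorem measurable_moebiusWeight (a : ℝ) (w : ℂ) : Measurable (moebiusWeight a w) := by
  unfold moebiusWeight
  fun_prop

theorem moebiusWeight_nonneg {a : ℝ} {w : ℂ} (hw : ‖w‖ < 1) (z : ℂ) : 0 ≤ moebiusWeight a w z := by
  have := one_sub_norm_sq_pos hw
  unfold moebiusWeight
  positivity

/-- As an equality of measures, the change of variables also transports integrability and Bochner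
integrals. -/
theorem discMeasure_eq_map_moebius (a : ℝ) {w : ℂ} (hw : ‖w‖ < 1) :
    discMeasure a = ((discMeasure a).withDensity fun z =>
      ENNReal.ofReal (moebiusWeight a w z)).map (moebius w) := by
  ext s hs
  rw [← lintegral_indicator_one hs, lintegral_discMeasure_comp_moebius a hw,
    Measure.map_apply (measurable_moebius w) hs,
    withDensity_apply _ (measurable_moebius w hs),
    ← lintegral_indicator (measurable_moebius w hs)]
  congr 1
  ext z
  by_cases hz : moebius w z ∈ s <;> simp [Set.indicator, hz]

theorem integral_discMeasure_comp_moebius (a : ℝ) {w : ℂ} (hw : ‖w‖ < 1) {F : ℂ → ℂ}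
    (hF : Integrable F (discMeasure a)) :
    Integrable (fun z => moebiusWeight a w z • F (moebius w z)) (discMeasure a) ∧
    ∫ z, F z ∂discMeasure a =
      ∫ z, moebiusWeight a w z • F (moebius w z) ∂discMeasure a := by
  have hm := (measurable_moebiusWeight a w).ennreal_ofReal
  have hfin : ∀ᵐ z ∂discMeasure a, ENNReal.ofReal (moebiusWeight a w z) < ∞ :=
    Filter.Eventually.of_forall fun _ => ENNReal.ofReal_lt_top
  have hr : ∀ z, (ENNReal.ofReal (moebiusWeight a w z)).toReal = moebiusWeight a w z := fun z =>
    ENNReal.toReal_ofReal (moebiusWeight_nonneg hw z)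
  have hF' := hF
  rw [discMeasure_eq_map_moebius a hw] at hF'
  constructor
  · have h := (integrable_map_measure hF'.1 (measurable_moebius w).aemeasurable).1 hF'
    rw [integrable_withDensity_iff_integrable_smul' hm hfin] at h
    simpa [hr] using h
  · conv_lhs => rw [discMeasure_eq_map_moebius a hw]
    rw [integral_map (measurable_moebius w).aemeasurable hF'.1,
      integral_withDensity_eq_integral_toReal_smul hm hfin]
    simp [hr]

theorem measurePreserving_mul_discMeasure (a : ℝ) {c : ℂ} (hc : ‖c‖ = 1) :
    MeasurePreserving (fun z => c * z) (discMeasure a) (discMeasure a) := by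
  have hm : Measurable fun z : ℂ => c * z := by fun_prop
  have hv : MeasurePreserving (fun z : ℂ => c * z) volume volume := by
    have := (rotation (⟨c, mem_sphere_zero_iff_norm.2 hc⟩ : Circle)).measurePreserving
    exact this
  have hemb : MeasurableEmbedding fun z : ℂ => c * z :=
    measurableEmbedding_mulLeft₀ (by rintro rfl; simp at hc)
  refine ⟨hm, ?_⟩
  ext s hs
  have hpre : (fun z : ℂ => c * z) ⁻¹' Metric.ball 0 1 = Metric.ball 0 1 := by
    ext z
    simp [hc]
  have key := (hv.restrict_preimage_emb hemb (Metric.ball 0 1))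
  rw [hpre] at key
  rw [Measure.map_apply hm hs, ← lintegral_indicator_one hs, ← lintegral_indicator_one (hm hs),
    lintegral_discMeasure, lintegral_discMeasure]
  refine Eq.trans ?_ (key.lintegral_comp_emb hemb _)
  congr 1
  ext z
  simp only [discDensity, norm_mul, hc, one_mul, Set.indicator]
  rfl

/-- The measure is rotation invariant, so the integral equals its average over all rotations. After
Fubini, the average over the circle through a fixed z is G(0) by the mean value property. -/
theorem integral_discMeasure_eq_apply_zero {a : ℝ} (ha : -1 < a) {G : ℂ → ℂ}
    (hG : DifferentiableOn ℂ G (Metric.ball 0 1)) (hi : Integrable G (discMeasure a)) :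
    ∫ z, G z ∂discMeasure a = G 0 := by
  have := isProbabilityMeasure_discMeasure ha
  -- Nothing is assumed about `G` off the disc; cutting it off there makes it globally measurable,
  -- as Fubini requires.
  wlog hGm : Measurable G generalizing G
  · have hae : (Metric.ball (0 : ℂ) 1).indicator G =ᵐ[discMeasure a] G := by
      filter_upwards [ae_discMeasure_norm_lt_one a] with z hz
      exact Set.indicator_of_mem (mem_ball_zero_iff.2 hz) G
    have hm : Measurable ((Metric.ball (0 : ℂ) 1).indicator G) := by
      classical
      have h := hG.continuousOn.measurable_piecewise
        (g := fun _ => (0 : ℂ)) continuousOn_const measurableSet_ball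
      convert h using 1
      ext z
      simp [Set.indicator, Set.piecewise]
    have h := this (hG.congr fun z hz => Set.indicator_of_mem hz G) (hi.congr hae.symm) hm
    rw [integral_congr_ae hae, Set.indicator_of_mem (by simp)] at h
    exact h
  set T : Set ℝ := Set.Ioc 0 (2 * Real.pi)
  have hrot : ∀ θ : ℝ, MeasurePreserving (fun z => circleMap 0 1 θ * z) (discMeasure a)
      (discMeasure a) := fun θ => measurePreserving_mul_discMeasure a (by simp)
  have hprod : Integrable (Function.uncurry fun (θ : ℝ) (z : ℂ) => G (circleMap 0 1 θ * z))
      ((volume.restrict T).prod (discMeasure a)) := by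
    have hmeas : Measurable (Function.uncurry fun (θ : ℝ) (z : ℂ) => G (circleMap 0 1 θ * z)) := by
      refine hGm.comp ?_
      have := (continuous_circleMap 0 1).measurable
      fun_prop
    refine ⟨hmeas.aestronglyMeasurable, ?_⟩
    rw [hasFiniteIntegral_iff_enorm, lintegral_prod _ hmeas.enorm.aemeasurable]
    have : ∀ θ : ℝ, ∫⁻ z, ‖G (circleMap 0 1 θ * z)‖ₑ ∂discMeasure a
        = ∫⁻ z, ‖G z‖ₑ ∂discMeasure a := fun θ =>
      (hrot θ).lintegral_comp hGm.enorm
    simp only [Function.uncurry_apply_pair, this, lintegral_const, Measure.restrict_apply_univ]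
    refine ENNReal.mul_lt_top ?_ (by rw [Real.volume_Ioc]; exact ENNReal.ofReal_lt_top)
    exact hi.2
  have h1 := integral_integral_swap hprod
  have h2 : ∀ θ : ℝ, ∫ z, G (circleMap 0 1 θ * z) ∂discMeasure a = ∫ z, G z ∂discMeasure a := by
    intro θ
    have := integral_map (hrot θ).measurable.aemeasurable
      (f := G) (by rw [(hrot θ).map_eq]; exact hGm.aestronglyMeasurable)
    rw [(hrot θ).map_eq] at this
    exact this.symm
  have h3 : ∀ᵐ z ∂discMeasure a, ∫ θ in T, G (circleMap 0 1 θ * z) = 2 * Real.pi * G 0 := by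
    filter_upwards [ae_discMeasure_norm_lt_one a] with z hz
    have hd : DiffContOnCl ℂ (fun ζ => G (ζ * z)) (Metric.ball 0 |1|) := by
      refine DifferentiableOn.diffContOnCl ?_
      refine hG.comp (by fun_prop) ?_
      intro ζ hζ
      rw [abs_one, closure_ball _ one_ne_zero, mem_closedBall_zero_iff] at hζ
      rw [mem_ball_zero_iff, norm_mul]
      exact lt_of_le_of_lt (mul_le_of_le_one_left (norm_nonneg z) hζ) hz
    have h := hd.circleAverage
    rw [Real.circleAverage, intervalIntegral.integral_of_le (by positivity), zero_mul] at h
    rw [← h]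
    have hpi : (Real.pi : ℂ) ≠ 0 := by exact_mod_cast Real.pi_ne_zero
    simp only [Complex.real_smul, T]
    push_cast
    rw [mul_inv_cancel_left₀ (mul_ne_zero two_ne_zero hpi)]
  rw [integral_congr_ae h3] at h1
  simp only [h2, integral_const, T, Measure.real, Measure.restrict_apply_univ, measure_univ,
    Real.volume_Ioc, sub_zero, ENNReal.toReal_one, one_smul,
    ENNReal.toReal_ofReal Real.two_pi_pos.le, Complex.real_smul] at h1
  have hpi : (Real.pi : ℂ) ≠ 0 := by exact_mod_cast Real.pi_ne_zero
  push_cast at h1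
  exact mul_left_cancel₀ (mul_ne_zero two_ne_zero hpi) h1

/-- The reproducing kernel of the disc. -/
def discKernel (a : ℝ) (z w : ℂ) : ℂ := 1 / (1 - z * conj w) ^ ((a + 2 : ℝ) : ℂ)

theorem conj_discKernel (a : ℝ) {z w : ℂ} (hz : ‖z‖ < 1) (hw : ‖w‖ < 1) :
    conj (discKernel a z w) = discKernel a w z := by
  have h := re_one_sub_pos (norm_mul_conj_lt_one hz hw)
  rw [discKernel, discKernel, map_div₀, map_one, ← conj_cpow_of_re_pos h]
  congr 3
  simp only [map_sub, map_mul, map_one, Complex.conj_conj]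
  ring

theorem norm_discKernel (a : ℝ) {z w : ℂ} (hz : ‖z‖ < 1) (hw : ‖w‖ < 1) :
    ‖discKernel a z w‖ = (‖1 - z * conj w‖ ^ (a + 2))⁻¹ := by
  rw [discKernel, norm_div, norm_one, norm_cpow_ofReal
    (re_one_sub_pos (norm_mul_conj_lt_one hz hw)), one_div]

theorem discKernel_ne_zero (a : ℝ) {z w : ℂ} (hz : ‖z‖ < 1) (hw : ‖w‖ < 1) :
    discKernel a z w ≠ 0 := by
  rw [← norm_ne_zero_iff, norm_discKernel a hz hw]
  have : 0 < ‖1 - z * conj w‖ := norm_pos_iff.2 (one_sub_mul_conj_ne_zero hw hz)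
  positivity

theorem differentiableOn_discKernel (a : ℝ) {w : ℂ} (hw : ‖w‖ < 1) :
    DifferentiableOn ℂ (fun z => discKernel a z w) (Metric.ball 0 1) := by
  intro z hz
  rw [mem_ball_zero_iff] at hz
  have h := re_one_sub_pos (norm_mul_conj_lt_one hz hw)
  have h1 : (1 - z * conj w) ^ ((a + 2 : ℝ) : ℂ) ≠ 0 := by
    simp [Complex.cpow_eq_zero_iff, one_sub_mul_conj_ne_zero hw hz]
  refine DifferentiableAt.differentiableWithinAt ?_
  unfold discKernel
  refine (differentiableAt_const _).div ?_ h1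
  exact (by fun_prop : DifferentiableAt ℂ (fun z => 1 - z * conj w) z).cpow
    (differentiableAt_const _) (Or.inl h)

theorem measurable_discKernel (a : ℝ) :
    Measurable fun p : ℂ × ℂ => discKernel a p.1 p.2 := by
  unfold discKernel
  have : Measurable (conj : ℂ → ℂ) := Complex.continuous_conj.measurable
  fun_prop

theorem norm_discKernel_le {a : ℝ} (ha : -1 < a) {z w : ℂ} {r : ℝ} (hr : r < 1) (hz : ‖z‖ < 1)
    (hw : ‖w‖ ≤ r) : ‖discKernel a z w‖ ≤ ((1 - r) ^ (a + 2))⁻¹ := by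
  rw [norm_discKernel a hz (hw.trans_lt hr)]
  have h1 : 1 - r ≤ ‖1 - z * conj w‖ := by
    have h2 := norm_sub_norm_le (1 : ℂ) (z * conj w)
    rw [norm_one, norm_mul, Complex.norm_conj] at h2
    nlinarith [norm_nonneg z, norm_nonneg w]
  have h3 : 0 < 1 - r := by linarith
  gcongr
  linarith

/-- The weight times the kernel simplifies after the Möbius substitution. -/
theorem moebiusWeight_mul_discKernel (a : ℝ) {w z : ℂ} (hw : ‖w‖ < 1) (hz : ‖z‖ < 1) :
    (moebiusWeight a w z : ℂ) * discKernel a w (moebius w z) = discKernel a z w := by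
  have h0 := one_sub_norm_sq_pos hw
  have hφ := norm_moebius_lt_one hw hz
  have hre := re_one_sub_pos (norm_mul_conj_lt_one hz hw)
  have hne := discKernel_ne_zero a hz hw
  have hconj : (starRingEnd ℂ) (discKernel a z w) ≠ 0 := by simpa using hne
  -- This is the case of the power rule coming from (1 - φ_w(z) w̄)(1 - z w̄) = 1 - |w|², with the
  -- two spare factors set to 1.
  have key : discKernel a w (moebius w z) =
      (((1 - ‖w‖ ^ 2) ^ (a + 2) : ℝ) : ℂ)⁻¹ * (conj (discKernel a z w))⁻¹ := by
    rw [← conj_discKernel a hφ hw]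
    have h := cpow_mul_mul_eq_of_re_pos (x := 1 - moebius w z * conj w) (y := 1 - z * conj w)
      (z := 1) (d := 1) (re_one_sub_pos (norm_mul_conj_lt_one hφ hw)) hre (by simp) (by simp) h0
      (by
        have := one_sub_conj_mul_moebius hw hz
        rw [mul_comm (moebius w z), this, mul_comm z, mul_one, mul_one,
          div_mul_cancel₀ _ (one_sub_conj_mul_ne_zero hw hz)]) ((a + 2 : ℝ) : ℂ)
    rw [Complex.one_cpow, mul_one, mul_one, ← Complex.ofReal_cpow h0.le] at h
    have h2 : (1 - z * conj w) ^ ((a + 2 : ℝ) : ℂ) ≠ 0 := by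
      simp [Complex.cpow_eq_zero_iff, one_sub_mul_conj_ne_zero hw hz]
    rw [discKernel, discKernel, ← eq_div_iff h2] at *
    rw [h]
    simp only [map_div₀, map_one, Complex.conj_ofReal]
    rw [one_div_div, one_div, inv_inv]
    field_simp
  have hw1 : (moebiusWeight a w z : ℂ) = (((1 - ‖w‖ ^ 2) ^ (a + 2) : ℝ) : ℂ) *
      (discKernel a z w * conj (discKernel a z w)) := by
    rw [Complex.mul_conj, Complex.normSq_eq_norm_sq, norm_discKernel a hz hw, moebiusWeight,
      mul_comm z]
    push_cast
    ring
  have h1 : (((1 - ‖w‖ ^ 2) ^ (a + 2) : ℝ) : ℂ) ≠ 0 := by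
    exact_mod_cast (Real.rpow_pos_of_pos h0 _).ne'
  rw [key, hw1]
  field_simp

theorem integrable_mul_discKernel {a : ℝ} (ha : -1 < a) {F : ℂ → ℂ}
    (hi : Integrable F (discMeasure a)) {w : ℂ} (hw : ‖w‖ < 1) :
    Integrable (fun z => F z * discKernel a w z) (discMeasure a) := by
  refine hi.mul_bdd (c := ((1 - ‖w‖) ^ (a + 2))⁻¹) ?_ ?_
  · exact ((measurable_discKernel a).comp measurable_prodMk_left).aestronglyMeasurable
  · filter_upwards [ae_discMeasure_norm_lt_one a] with z hz
    rw [← conj_discKernel a hz hw, Complex.norm_conj]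
    exact norm_discKernel_le ha hw hz le_rfl

/-- The reproducing formula of the disc. -/
theorem integral_mul_discKernel {a : ℝ} (ha : -1 < a) {F : ℂ → ℂ}
    (hF : DifferentiableOn ℂ F (Metric.ball 0 1)) (hi : Integrable F (discMeasure a))
    {w : ℂ} (hw : ‖w‖ < 1) : ∫ z, F z * discKernel a w z ∂discMeasure a = F w := by
  -- The substitution z ↦ φ_w(z) turns F · K(w, ·) into the holomorphic function F∘φ_w · K(·, w).
  -- Its mean value is taken at 0, where φ_w equals w and the kernel equals 1.
  obtain ⟨h1, h2⟩ := integral_discMeasure_comp_moebius a hw (integrable_mul_discKernel ha hi hw)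
  have hae : (fun z => moebiusWeight a w z • (F (moebius w z) * discKernel a w (moebius w z)))
      =ᵐ[discMeasure a] fun z => F (moebius w z) * discKernel a z w := by
    filter_upwards [ae_discMeasure_norm_lt_one a] with z hz
    rw [← moebiusWeight_mul_discKernel a hw hz, Complex.real_smul]
    ring
  rw [h2, integral_congr_ae hae, integral_discMeasure_eq_apply_zero ha ?_ (h1.congr hae),
    moebius_zero_right]
  · simp [discKernel]
  · refine DifferentiableOn.mul (hF.comp (fun z hz => ?_) fun z hz => ?_)
      (differentiableOn_discKernel a hw)
    · exact (hasDerivAt_moebius hw (mem_ball_zero_iff.1 hz)).differentiableAt.differentiableWithinAt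
    · exact mem_ball_zero_iff.2 (norm_moebius_lt_one hw (mem_ball_zero_iff.1 hz))

/-! ### The weighted measure and the kernel of the polydisc -/

theorem polydisc_eq_ball (n : ℕ) : polydisc n = Metric.ball 0 1 := by
  ext z
  simp [polydisc, pi_norm_lt_iff]

theorem isOpen_polydisc (n : ℕ) : IsOpen (polydisc n) := by
  rw [polydisc_eq_ball]
  exact Metric.isOpen_ball

theorem isProbabilityMeasure_weightedMeasure {n : ℕ} {α : Fin n → ℝ} (hα : ∀ j, -1 < α j) :
    IsProbabilityMeasure (weightedMeasure α) := by
  have := fun j => isProbabilityMeasure_discMeasure (hα j)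
  unfold weightedMeasure
  infer_instance

theorem ae_weightedMeasure_mem_polydisc {n : ℕ} {α : Fin n → ℝ} (hα : ∀ j, -1 < α j) :
    ∀ᵐ z ∂weightedMeasure α, z ∈ polydisc n := by
  have := fun j => isProbabilityMeasure_discMeasure (hα j)
  refine (ae_all_iff (p := fun (z : Fin n → ℂ) j => ‖z j‖ < 1)).2 fun j => ?_
  exact (Measure.quasiMeasurePreserving_eval (μ := fun j => discMeasure (α j)) j).ae
    (ae_discMeasure_norm_lt_one (α j))

theorem kernel_eq_prod {n : ℕ} (α : Fin n → ℝ) (z w : Fin n → ℂ) :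
    kernel α z w = ∏ j, discKernel (α j) (z j) (w j) := rfl

theorem conj_kernel {n : ℕ} (α : Fin n → ℝ) {z w : Fin n → ℂ} (hz : z ∈ polydisc n)
    (hw : w ∈ polydisc n) : conj (kernel α z w) = kernel α w z := by
  rw [kernel_eq_prod, kernel_eq_prod, map_prod]
  exact Finset.prod_congr rfl fun j _ => conj_discKernel (α j) (hz j) (hw j)

theorem measurable_discKernel_apply (a : ℝ) {n : ℕ} (j : Fin n) :
    Measurable fun p : (Fin n → ℂ) × (Fin n → ℂ) => discKernel a (p.1 j) (p.2 j) := by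
  have h : Measurable fun p : (Fin n → ℂ) × (Fin n → ℂ) => (p.1 j, p.2 j) := by fun_prop
  have h2 := (measurable_discKernel a).comp h
  exact h2

theorem measurable_kernel {n : ℕ} (α : Fin n → ℝ) :
    Measurable fun p : (Fin n → ℂ) × (Fin n → ℂ) => kernel α p.1 p.2 := by
  have h := Finset.measurable_fun_prod Finset.univ
    fun (j : Fin n) _ => measurable_discKernel_apply (α j) j
  exact h

/-- The derivative of `z ↦ discKernel a z w`. -/
def discKernelDeriv (a : ℝ) (z w : ℂ) : ℂ :=
  ((a + 2 : ℝ) : ℂ) * (1 - z * conj w) ^ (((a + 2 : ℝ) : ℂ) - 1) * conj w /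
    ((1 - z * conj w) ^ ((a + 2 : ℝ) : ℂ)) ^ 2

theorem hasDerivAt_discKernel (a : ℝ) {z w : ℂ} (hz : ‖z‖ < 1) (hw : ‖w‖ < 1) :
    HasDerivAt (fun x => discKernel a x w) (discKernelDeriv a z w) z := by
  have h := re_one_sub_pos (norm_mul_conj_lt_one hz hw)
  have h1 : (1 - z * conj w) ^ ((a + 2 : ℝ) : ℂ) ≠ 0 := by
    simp [Complex.cpow_eq_zero_iff, one_sub_mul_conj_ne_zero hw hz]
  have h2 : HasDerivAt (fun x : ℂ => 1 - x * conj w) (-conj w) z := by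
    simpa using ((hasDerivAt_id z).mul_const (conj w)).const_sub 1
  have h3 := (hasDerivAt_const z (1 : ℂ)).div
    (h2.cpow_const (c := ((a + 2 : ℝ) : ℂ)) (Or.inl h)) h1
  refine h3.congr_deriv ?_
  rw [discKernelDeriv]
  ring

/-- The derivative of `z ↦ K(z, w)`. -/
def kernelDeriv {n : ℕ} (α : Fin n → ℝ) (z w : Fin n → ℂ) : (Fin n → ℂ) →L[ℂ] ℂ :=
  ∑ i, (∏ j ∈ Finset.univ.erase i, discKernel (α j) (z j) (w j)) •
    (discKernelDeriv (α i) (z i) (w i) •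
      ContinuousLinearMap.proj (R := ℂ) (φ := fun _ : Fin n => ℂ) i)

theorem hasFDerivAt_kernel {n : ℕ} (α : Fin n → ℝ) {z w : Fin n → ℂ} (hz : z ∈ polydisc n)
    (hw : w ∈ polydisc n) : HasFDerivAt (fun z => kernel α z w) (kernelDeriv α z w) z := by
  have h := HasFDerivAt.finsetProd (𝕜 := ℂ) (x := z) (u := Finset.univ)
    (g := fun (j : Fin n) (z : Fin n → ℂ) => discKernel (α j) (z j) (w j))
    (g' := fun i => discKernelDeriv (α i) (z i) (w i) •
      ContinuousLinearMap.proj (R := ℂ) (φ := fun _ : Fin n => ℂ) i) (fun i _ => ?_)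
  · exact h
  · have h1 := (hasDerivAt_discKernel (α i) (hz i) (hw i)).comp_hasFDerivAt
      (f := fun z : Fin n → ℂ => z i) z
      (ContinuousLinearMap.proj (R := ℂ) (φ := fun _ : Fin n => ℂ) i).hasFDerivAt
    exact h1

theorem measurable_kernelDeriv {n : ℕ} (α : Fin n → ℝ) (z : Fin n → ℂ) :
    Measurable fun w => kernelDeriv α z w := by
  have hc : Measurable (conj : ℂ → ℂ) := Complex.continuous_conj.measurable
  have h1 : ∀ i : Fin n, Measurable fun w : Fin n → ℂ => discKernelDeriv (α i) (z i) (w i) := by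
    intro i
    unfold discKernelDeriv
    fun_prop
  have h2 : ∀ i : Fin n, Measurable fun w : Fin n → ℂ =>
      ∏ j ∈ Finset.univ.erase i, discKernel (α j) (z j) (w j) := by
    intro i
    refine Finset.measurable_fun_prod _ fun j _ => ?_
    unfold discKernel
    fun_prop
  unfold kernelDeriv
  refine Finset.measurable_fun_sum _ fun i _ => ?_
  exact (h2 i).smul ((h1 i).smul_const _)

theorem differentiableOn_kernel {n : ℕ} (α : Fin n → ℝ) {w : Fin n → ℂ} (hw : w ∈ polydisc n) :
    DifferentiableOn ℂ (fun z => kernel α z w) (polydisc n) := fun _ hz =>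
  (hasFDerivAt_kernel α hz hw).differentiableAt.differentiableWithinAt

theorem norm_kernel_le {n : ℕ} {α : Fin n → ℝ} (hα : ∀ j, -1 < α j) {z w : Fin n → ℂ} {r : ℝ}
    (hr : r < 1) (hz : z ∈ polydisc n) (hw : ‖w‖ ≤ r) :
    ‖kernel α z w‖ ≤ ∏ j, ((1 - r) ^ (α j + 2))⁻¹ := by
  rw [kernel_eq_prod, norm_prod]
  exact Finset.prod_le_prod (fun _ _ => norm_nonneg _) fun j _ =>
    norm_discKernel_le (hα j) hr (hz j) ((norm_le_pi_norm w j).trans hw)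

theorem norm_lt_one_of_mem_polydisc {n : ℕ} {w : Fin n → ℂ} (hw : w ∈ polydisc n) : ‖w‖ < 1 := by
  rwa [polydisc_eq_ball, mem_ball_zero_iff] at hw

theorem mem_polydisc_of_norm_lt_one {n : ℕ} {w : Fin n → ℂ} (hw : ‖w‖ < 1) : w ∈ polydisc n := by
  rwa [polydisc_eq_ball, mem_ball_zero_iff]

theorem integrable_mul_kernel {n : ℕ} {α : Fin n → ℝ} (hα : ∀ j, -1 < α j)
    {F : (Fin n → ℂ) → ℂ} (hi : Integrable F (weightedMeasure α)) {w : Fin n → ℂ}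
    (hw : w ∈ polydisc n) : Integrable (fun z => F z * kernel α w z) (weightedMeasure α) := by
  refine hi.mul_bdd (c := ∏ j, ((1 - ‖w‖) ^ (α j + 2))⁻¹) ?_ ?_
  · exact ((measurable_kernel α).comp measurable_prodMk_left).aestronglyMeasurable
  · filter_upwards [ae_weightedMeasure_mem_polydisc hα] with z hz
    rw [← conj_kernel α hz hw, Complex.norm_conj]
    exact norm_kernel_le hα (norm_lt_one_of_mem_polydisc hw) hz le_rfl

theorem measurePreserving_cons {n : ℕ} {α : Fin (n + 1) → ℝ} (hα : ∀ j, -1 < α j) :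
    MeasurePreserving (MeasurableEquiv.piFinSuccAbove (fun _ => ℂ) 0).symm
      ((discMeasure (α 0)).prod (weightedMeasure fun j => α j.succ)) (weightedMeasure α) := by
  have := fun j => isProbabilityMeasure_discMeasure (hα j)
  exact (measurePreserving_piFinSuccAbove (fun j => discMeasure (α j)) 0).symm

theorem piFinSuccAbove_zero_symm_apply {n : ℕ} (p : ℂ × (Fin n → ℂ)) :
    (MeasurableEquiv.piFinSuccAbove (fun _ : Fin (n + 1) => ℂ) 0).symm p = Fin.cons p.1 p.2 := by
  simp [MeasurableEquiv.piFinSuccAbove_symm_apply, Fin.insertNthEquiv]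

theorem cons_mem_polydisc {n : ℕ} {x : ℂ} {y : Fin n → ℂ} (hx : ‖x‖ < 1) (hy : y ∈ polydisc n) :
    (Fin.cons x y : Fin (n + 1) → ℂ) ∈ polydisc (n + 1) := by
  intro j
  refine Fin.cases ?_ (fun i => ?_) j
  · simpa using hx
  · simpa using hy i

/-- The reproducing formula of the polydisc for integrable holomorphic functions. -/
theorem integral_mul_kernel {n : ℕ} {α : Fin n → ℝ} (hα : ∀ j, -1 < α j)
    {F : (Fin n → ℂ) → ℂ} (hF : DifferentiableOn ℂ F (polydisc n))
    (hi : Integrable F (weightedMeasure α)) {w : Fin n → ℂ} (hw : w ∈ polydisc n) :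
    ∫ z, F z * kernel α w z ∂weightedMeasure α = F w := by
  induction n with
  | zero =>
    rw [weightedMeasure, Measure.pi_of_empty _ w, integral_dirac]
    simp [kernel]
  | succ n ih =>
    have hα' : ∀ j : Fin n, -1 < α j.succ := fun j => hα j.succ
    have hP1 := isProbabilityMeasure_discMeasure (hα 0)
    have hP2 := isProbabilityMeasure_weightedMeasure hα'
    have hw' : (fun j : Fin n => w j.succ) ∈ polydisc n := fun j => hw j.succ
    have hmp := measurePreserving_cons hα
    have hint := integrable_mul_kernel hα hi hw
    rw [← hmp.integrable_comp_emb (MeasurableEquiv.measurableEmbedding _)] at hint hi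
    rw [← hmp.integral_comp']
    simp only [Function.comp_def, piFinSuccAbove_zero_symm_apply] at hint hi ⊢
    have hK : ∀ (x : ℂ) (y : Fin n → ℂ), kernel α w (Fin.cons x y) =
        discKernel (α 0) (w 0) x * kernel (fun j => α j.succ) (fun j => w j.succ) y := by
      intro x y
      simp [kernel_eq_prod, Fin.prod_univ_succ]
    simp only [hK] at hint ⊢
    rw [integral_prod_symm _ hint]
    -- Integrability of the slice F(w₀, ·), which the induction needs, is not evident. Keeping only
    -- the first kernel factor exhibits this slice almost everywhere as a marginal of an integrable
    -- function.
    have hi1 : Integrable (fun p : ℂ × (Fin n → ℂ) =>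
        F (Fin.cons p.1 p.2) * discKernel (α 0) (w 0) p.1)
        ((discMeasure (α 0)).prod (weightedMeasure fun j => α j.succ)) := by
      refine hi.mul_bdd (c := ((1 - ‖w 0‖) ^ (α 0 + 2))⁻¹) ?_ ?_
      · exact ((measurable_discKernel (α 0)).comp
          (measurable_const.prodMk measurable_fst)).aestronglyMeasurable
      · have := (Measure.quasiMeasurePreserving_fst (μ := discMeasure (α 0))
          (ν := weightedMeasure fun j => α j.succ)).ae (ae_discMeasure_norm_lt_one (α 0))
        filter_upwards [this] with p hp
        rw [← conj_discKernel (α 0) hp (hw 0), Complex.norm_conj]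
        exact norm_discKernel_le (hα 0) (hw 0) hp le_rfl
    have hslice : ∀ᵐ y ∂weightedMeasure fun j => α (Fin.succ j),
        ∫ x, F (Fin.cons x y) * discKernel (α 0) (w 0) x ∂discMeasure (α 0)
          = F (Fin.cons (w 0) y) := by
      filter_upwards [ae_weightedMeasure_mem_polydisc hα', hi.prod_left_ae] with y hy hiy
      refine integral_mul_discKernel (F := fun x => F (Fin.cons x y)) (hα 0) ?_ hiy (hw 0)
      refine hF.comp (f := fun x : ℂ => (Fin.cons x y : Fin (n + 1) → ℂ)) ?_ fun x hx =>
        cons_mem_polydisc (mem_ball_zero_iff.1 hx) hy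
      refine (differentiable_pi.2 fun j => ?_).differentiableOn
      refine Fin.cases ?_ (fun i => ?_) j <;> simp
    have hcongr : (fun y => ∫ x, F (Fin.cons x y) * (discKernel (α 0) (w 0) x *
        kernel (fun j => α (Fin.succ j)) (fun j => w j.succ) y) ∂discMeasure (α 0))
        =ᵐ[weightedMeasure fun j => α (Fin.succ j)] fun y =>
        F (Fin.cons (w 0) y) * kernel (fun j => α (Fin.succ j)) (fun j => w j.succ) y := by
      filter_upwards [hslice] with y hy
      simp only [← mul_assoc]
      rw [integral_mul_const, hy]
    have hi2 : Integrable (fun y : Fin n → ℂ => F (Fin.cons (w 0) y))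
        (weightedMeasure fun j => α j.succ) := hi1.integral_prod_right.congr hslice
    rw [integral_congr_ae hcongr, ih hα' ?_ hi2 hw']
    · congr 1
      exact Fin.cons_self_tail w
    · refine hF.comp (f := fun y : Fin n → ℂ => (Fin.cons (w 0) y : Fin (n + 1) → ℂ)) ?_
        fun y hy => cons_mem_polydisc (hw 0) hy
      refine (differentiable_pi.2 fun j => ?_).differentiableOn
      refine Fin.cases ?_ (fun i => ?_) j
      · simp
      · simp only [Fin.cons_succ]
        fun_prop

theorem memLp_kernel {n : ℕ} {α : Fin n → ℝ} (hα : ∀ j, -1 < α j) (p : ℝ≥0∞) {w : Fin n → ℂ}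
    (hw : w ∈ polydisc n) : MemLp (fun z => kernel α z w) p (weightedMeasure α) := by
  have := isProbabilityMeasure_weightedMeasure hα
  refine MemLp.of_bound ?_ (∏ j, ((1 - ‖w‖) ^ (α j + 2))⁻¹) ?_
  · exact ((measurable_kernel α).comp measurable_prodMk_right).aestronglyMeasurable
  · filter_upwards [ae_weightedMeasure_mem_polydisc hα] with z hz
    exact norm_kernel_le hα (norm_lt_one_of_mem_polydisc hw) hz le_rfl

theorem discKernel_self (a : ℝ) {w : ℂ} (hw : ‖w‖ < 1) :
    discKernel a w w = (((1 - ‖w‖ ^ 2) ^ (a + 2) : ℝ) : ℂ)⁻¹ := by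
  have h : (1 : ℂ) - w * conj w = ((1 - ‖w‖ ^ 2 : ℝ) : ℂ) := by
    rw [Complex.mul_conj, Complex.normSq_eq_norm_sq]
    push_cast
    ring
  rw [discKernel, h, Complex.ofReal_cpow (one_sub_norm_sq_pos hw).le, one_div]

/-- The factor `∏ⱼ (1 - |wⱼ|²)^{αⱼ + 2}`, the reciprocal of `‖K_w‖₂²`. -/
def kernelWeight {n : ℕ} (α : Fin n → ℝ) (w : Fin n → ℂ) : ℝ :=
  ∏ j, (1 - ‖w j‖ ^ 2) ^ (α j + 2)

theorem kernelWeight_pos {n : ℕ} (α : Fin n → ℝ) {w : Fin n → ℂ} (hw : w ∈ polydisc n) :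
    0 < kernelWeight α w :=
  Finset.prod_pos fun j _ => Real.rpow_pos_of_pos (one_sub_norm_sq_pos (hw j)) _

theorem kernel_self {n : ℕ} (α : Fin n → ℝ) {w : Fin n → ℂ} (hw : w ∈ polydisc n) :
    kernel α w w = ((kernelWeight α w : ℝ) : ℂ)⁻¹ := by
  rw [kernel_eq_prod, kernelWeight, Complex.ofReal_prod, ← Finset.prod_inv_distrib]
  exact Finset.prod_congr rfl fun j _ => discKernel_self (α j) (hw j)

/-- The reproducing formula applied to K_w itself gives ‖K_w‖₂² = K(w, w). -/
theorem bergmanNorm_two_kernel_sq {n : ℕ} {α : Fin n → ℝ} (hα : ∀ j, -1 < α j) {w : Fin n → ℂ}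
    (hw : w ∈ polydisc n) :
    (bergmanNorm α 2 fun u => kernel α u w).toReal ^ 2 = (kernelWeight α w)⁻¹ := by
  have := isProbabilityMeasure_weightedMeasure hα
  have hL := memLp_kernel hα (ENNReal.ofReal 2) hw
  have hI : ∫ z, ‖kernel α z w‖ ^ (2 : ℝ) ∂weightedMeasure α = (kernelWeight α w)⁻¹ := by
    have h1 := integral_mul_kernel hα (differentiableOn_kernel α hw)
      ((memLp_kernel hα 1 hw).integrable le_rfl) hw
    have h2 : ∫ z, kernel α z w * kernel α w z ∂weightedMeasure α =
        ∫ z, ((‖kernel α z w‖ ^ (2 : ℝ) : ℝ) : ℂ) ∂weightedMeasure α := by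
      refine integral_congr_ae ?_
      filter_upwards [ae_weightedMeasure_mem_polydisc hα] with z hz
      rw [← conj_kernel α hz hw, Complex.mul_conj, Complex.normSq_eq_norm_sq, Real.rpow_two]
    rw [h2, integral_complex_ofReal, kernel_self α hw] at h1
    exact_mod_cast h1
  rw [bergmanNorm, hL.eLpNorm_eq_integral_rpow_norm (by simp) (by simp),
    ENNReal.toReal_ofReal zero_le_two, hI,
    ENNReal.toReal_ofReal (Real.rpow_nonneg (inv_nonneg.2 (kernelWeight_pos α hw).le) _),
    ← Real.rpow_mul_natCast (inv_nonneg.2 (kernelWeight_pos α hw).le)]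
  norm_num

/-- Only this product enters the expansion, so the square of the norm of K_w suffices and no root
has to be extracted. -/
theorem normalizedKernel_mul_conj {n : ℕ} {α : Fin n → ℝ} (hα : ∀ j, -1 < α j)
    {w z u : Fin n → ℂ} (hw : w ∈ polydisc n) (hu : u ∈ polydisc n) :
    normalizedKernel α w z * conj (normalizedKernel α w u) =
      kernelWeight α w * (kernel α z w * kernel α w u) := by
  have h := congrArg (fun x : ℝ => (x : ℂ)) (bergmanNorm_two_kernel_sq hα hw)
  simp only [Complex.ofReal_pow, Complex.ofReal_inv] at h
  have h' := inv_eq_iff_eq_inv.2 h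
  rw [normalizedKernel, normalizedKernel, map_div₀, Complex.conj_ofReal, conj_kernel α hu hw,
    ← inv_inv ((kernelWeight α w : ℝ) : ℂ), ← h]
  ring

theorem differentiableOn_normalizedKernel {n : ℕ} (α : Fin n → ℝ) {w : Fin n → ℂ}
    (hw : w ∈ polydisc n) : DifferentiableOn ℂ (normalizedKernel α w) (polydisc n) :=
  (differentiableOn_kernel α hw).mul_const
    (((bergmanNorm α 2 fun u => kernel α u w).toReal : ℂ)⁻¹)

/-! ### Boundedness of the absolute Bergman projection -/

/-- The Schur test. -/
theorem lintegral_rpow_lintegral_le_of_schur {X : Type*} [MeasurableSpace X] {μ : Measure X}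
    [SFinite μ] {p q : ℝ} (hpq : p.HolderConjugate q) {k : X → X → ℝ≥0∞}
    (hk : Measurable (Function.uncurry k)) {h : X → ℝ≥0∞} (hm : Measurable h)
    (h0 : ∀ᵐ x ∂μ, h x ≠ 0) (htop : ∀ᵐ x ∂μ, h x ≠ ∞) (C : ℝ≥0∞)
    (h1 : ∀ᵐ x ∂μ, ∫⁻ y, k x y * h y ^ q ∂μ ≤ C * h x ^ q)
    (h2 : ∀ᵐ y ∂μ, ∫⁻ x, k x y * h x ^ p ∂μ ≤ C * h y ^ p)
    {ψ : X → ℝ≥0∞} (hψ : Measurable ψ) :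
    ∫⁻ x, (∫⁻ y, k x y * ψ y ∂μ) ^ p ∂μ ≤ C ^ p * ∫⁻ y, ψ y ^ p ∂μ := by
  have hp := hpq.pos
  have hq := hpq.symm.pos
  have hk1 : ∀ x, Measurable (k x) := fun x => hk.comp measurable_prodMk_left
  have hk2 : ∀ y, Measurable fun x => k x y := fun y => hk.comp measurable_prodMk_right
  have hk' : Measurable fun z : X × X => k z.1 z.2 := hk
  have holder : ∀ᵐ x ∂μ, (∫⁻ y, k x y * ψ y ∂μ) ^ p ≤
      C ^ (p / q) * h x ^ p * ∫⁻ y, k x y * (h y ^ (-p) * ψ y ^ p) ∂μ := by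
    filter_upwards [h1] with x hx
    -- Hölder is applied to k ψ = (k^{1/p} h⁻¹ ψ)(k^{1/q} h); inserting h⁻¹ h is legitimate where h
    -- is neither 0 nor ∞.
    have e1 : ∫⁻ y, k x y * ψ y ∂μ =
        ∫⁻ y, ((fun y => k x y ^ (1 / p) * ((h y)⁻¹ * ψ y)) *
          fun y => k x y ^ (1 / q) * h y) y ∂μ := by
      refine lintegral_congr_ae ?_
      filter_upwards [h0, htop] with y hy0 hyt
      have : k x y = k x y ^ (1 / p) * k x y ^ (1 / q) := by
        rw [← ENNReal.rpow_add_of_nonneg _ _ (by positivity) (by positivity), one_div, one_div,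
          hpq.inv_add_inv_eq_one, ENNReal.rpow_one]
      simp only [Pi.mul_apply]
      calc k x y * ψ y = k x y ^ (1 / p) * k x y ^ (1 / q) * ψ y * ((h y)⁻¹ * h y) := by
            rw [ENNReal.inv_mul_cancel hy0 hyt, ← this, mul_one]
        _ = _ := by ring
    have e2 : ∀ y, (k x y ^ (1 / q) * h y) ^ q = k x y * h y ^ q := fun y => by
      rw [ENNReal.mul_rpow_of_nonneg _ _ hq.le, ← ENNReal.rpow_mul, one_div,
        inv_mul_cancel₀ hq.ne', ENNReal.rpow_one]
    have e3 : ∀ y, (k x y ^ (1 / p) * ((h y)⁻¹ * ψ y)) ^ p =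
        k x y * (h y ^ (-p) * ψ y ^ p) := fun y => by
      rw [ENNReal.mul_rpow_of_nonneg _ _ hp.le, ← ENNReal.rpow_mul, one_div,
        inv_mul_cancel₀ hp.ne', ENNReal.rpow_one, ENNReal.mul_rpow_of_nonneg _ _ hp.le,
        ENNReal.inv_rpow, ← ENNReal.rpow_neg]
    have e4 := ENNReal.lintegral_mul_le_Lp_mul_Lq μ hpq
      (f := fun y => k x y ^ (1 / p) * ((h y)⁻¹ * ψ y))
      (g := fun y => k x y ^ (1 / q) * h y)
      (((hk1 x).pow_const _).mul (hm.inv.mul hψ)).aemeasurable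
      (((hk1 x).pow_const _).mul hm).aemeasurable
    simp only [e2, e3] at e4
    rw [e1]
    calc _ ≤ ((∫⁻ y, k x y * (h y ^ (-p) * ψ y ^ p) ∂μ) ^ (1 / p) *
          (C * h x ^ q) ^ (1 / q)) ^ p := by
          refine ENNReal.rpow_le_rpow (e4.trans ?_) hp.le
          gcongr
      _ = _ := by
          have hq1 : q * (1 / q) = 1 := by field_simp
          have hp1 : 1 / p * p = 1 := by field_simp
          have hpq1 : 1 / q * p = p / q := by ring
          rw [ENNReal.mul_rpow_of_nonneg _ _ hp.le, ← ENNReal.rpow_mul, hp1, ENNReal.rpow_one,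
            ENNReal.mul_rpow_of_nonneg _ _ (by positivity : 0 ≤ 1 / q), ← ENNReal.rpow_mul, hq1,
            ENNReal.rpow_one, ENNReal.mul_rpow_of_nonneg _ _ hp.le, ← ENNReal.rpow_mul, hpq1]
          ring
  have hmR : Measurable fun y => h y ^ (-p) * ψ y ^ p := (hm.pow_const _).mul (hψ.pow_const _)
  calc ∫⁻ x, (∫⁻ y, k x y * ψ y ∂μ) ^ p ∂μ
      ≤ ∫⁻ x, C ^ (p / q) * h x ^ p * ∫⁻ y, k x y * (h y ^ (-p) * ψ y ^ p) ∂μ ∂μ :=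
        lintegral_mono_ae holder
    _ = ∫⁻ x, ∫⁻ y, C ^ (p / q) * h x ^ p * (k x y * (h y ^ (-p) * ψ y ^ p)) ∂μ ∂μ := by
        refine lintegral_congr fun x => ?_
        have hmx : Measurable fun y => k x y * (h y ^ (-p) * ψ y ^ p) := (hk1 x).mul hmR
        rw [lintegral_const_mul _ hmx]
    _ = ∫⁻ y, ∫⁻ x, C ^ (p / q) * h x ^ p * (k x y * (h y ^ (-p) * ψ y ^ p)) ∂μ ∂μ := by
        refine lintegral_lintegral_swap (Measurable.aemeasurable ?_)
        exact (measurable_const.mul ((hm.comp measurable_fst).pow_const _)).mul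
          (hk'.mul (hmR.comp measurable_snd))
    _ = ∫⁻ y, C ^ (p / q) * (h y ^ (-p) * ψ y ^ p) * ∫⁻ x, k x y * h x ^ p ∂μ ∂μ := by
        refine lintegral_congr fun y => ?_
        have hmy : Measurable fun x => k x y * h x ^ p := (hk2 y).mul (hm.pow_const _)
        rw [← lintegral_const_mul _ hmy]
        refine lintegral_congr fun x => ?_
        ring
    _ ≤ ∫⁻ y, C ^ p * ψ y ^ p ∂μ := by
        refine lintegral_mono_ae ?_
        filter_upwards [h0, htop, h2] with y hy0 hyt hy
        have hC : C ^ p = C ^ (p / q) * C := by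
          have : p = p / q + 1 := by
            have := hpq.inv_add_inv_eq_one
            field_simp at this ⊢
            linarith
          conv_lhs => rw [this]
          rw [ENNReal.rpow_add_of_nonneg _ _ (by positivity) zero_le_one, ENNReal.rpow_one]
        have hh : h y ^ (-p) * h y ^ p = 1 := by
          rw [← ENNReal.rpow_add _ _ hy0 hyt]
          simp
        calc _ ≤ C ^ (p / q) * (h y ^ (-p) * ψ y ^ p) * (C * h y ^ p) := by gcongr
          _ = C ^ (p / q) * C * ψ y ^ p * (h y ^ (-p) * h y ^ p) := by ring
          _ = _ := by rw [hh, hC, mul_one]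
    _ = _ := lintegral_const_mul _ (hψ.pow_const _)

/-- The distance from 1 to the line through 0 of direction θ is |sin θ|, at least 2|θ|/π when |θ| ≤
π/2. For larger angles the cosine is nonpositive and the distance to the ray is at least 1. -/
theorem abs_div_pi_le_norm_one_sub {r θ : ℝ} (hr : 0 ≤ r) (hθ : |θ| ≤ Real.pi) :
    |θ| / Real.pi ≤ ‖1 - (r : ℂ) * (Real.cos θ + Real.sin θ * Complex.I)‖ := by
  have hpi := Real.pi_pos
  have hsq : ‖1 - (r : ℂ) * (Real.cos θ + Real.sin θ * Complex.I)‖ ^ 2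
      = 1 - 2 * r * Real.cos θ + r ^ 2 := by
    rw [← Complex.normSq_eq_norm_sq, Complex.normSq_apply]
    simp [Complex.cos_ofReal_re, Complex.sin_ofReal_re, Complex.cos_ofReal_im,
      Complex.sin_ofReal_im]
    nlinarith [Real.sin_sq_add_cos_sq θ]
  refine abs_le_of_sq_le_sq' ?_ (norm_nonneg _) |>.2
  rw [hsq]
  rcases le_total |θ| (Real.pi / 2) with h | h
  · have h1 : 2 / Real.pi * |θ| ≤ Real.sin |θ| := Real.mul_le_sin (abs_nonneg _) h
    have h2 : Real.sin |θ| ^ 2 = Real.sin θ ^ 2 := by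
      rcases abs_choice θ with h | h <;> rw [h]
      simp
    have h3 : |θ| / Real.pi ≤ 2 / Real.pi * |θ| := by
      rw [div_mul_eq_mul_div]
      gcongr
      linarith [abs_nonneg θ]
    have h4 : (|θ| / Real.pi) ^ 2 ≤ Real.sin |θ| ^ 2 := by
      have : 0 ≤ |θ| / Real.pi := by positivity
      exact pow_le_pow_left₀ this (h3.trans h1) 2
    nlinarith [Real.sin_sq_add_cos_sq θ, sq_nonneg (r - Real.cos θ)]
  · have hc : Real.cos θ ≤ 0 := by
      rw [← Real.cos_abs]
      exact Real.cos_nonpos_of_pi_div_two_le_of_le h (by linarith)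
    have h1 : |θ| / Real.pi ≤ 1 := (div_le_one hpi).2 hθ
    have h0 : 0 ≤ |θ| / Real.pi := by positivity
    nlinarith [mul_nonneg hr (neg_nonneg.2 hc)]

theorem lintegral_abs_rpow_lt_top {b : ℝ} (hb : -1 < b) (R : ℝ) :
    ∫⁻ θ in Set.Ioo (-R) R, ENNReal.ofReal (|θ| ^ b) < ∞ := by
  have h : IntegrableOn (fun θ : ℝ => ‖θ‖ ^ b) (Metric.ball 0 R) := by
    rw [integrableOn_fun_norm_addHaar (f := fun y : ℝ => y ^ b) (μ := volume)]
    simp only [Module.finrank_self, tsub_self, pow_zero, one_smul]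
    rcases le_total R 0 with hR | hR
    · simp [Set.Ioo_eq_empty_of_le hR]
    · exact (intervalIntegrable_iff_integrableOn_Ioo_of_le hR).1
        (intervalIntegral.intervalIntegrable_rpow' hb)
  rw [Real.ball_eq_Ioo, zero_sub, zero_add] at h
  exact h.lintegral_lt_top

theorem lintegral_one_sub_sq_rpow_lt_top {b : ℝ} (hb : -1 < b) :
    ∫⁻ r in Set.Ioo (0 : ℝ) 1, ENNReal.ofReal (r * (1 - r ^ 2) ^ b) < ∞ := by
  have h := (integral_one_sub_sq_rpow hb).2
  rw [intervalIntegrable_iff_integrableOn_Ioo_of_le zero_le_one] at h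
  exact h.lintegral_lt_top

/-- Finiteness of the model integral in the estimate of the absolute projection. -/
theorem lintegral_one_sub_rpow_lt_top {a s : ℝ} (hs : 0 < s) (hs1 : s ≤ 1)
    (hsa : 2 * s ≤ a + 1) :
    ∫⁻ z, ENNReal.ofReal ((1 - ‖z‖ ^ 2) ^ (-s) * ‖1 - z‖ ^ (-(a + 2 - 2 * s))) ∂discMeasure a
      < ∞ := by
  have hpi := Real.pi_pos
  have ha : 0 < a + 1 := by linarith
  -- The exponent a + 2 - 2s is split as c1 + c2: c1 is spent on |1 - z| ≥ (1 - r²)/2 and c2 on |1 -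
  -- z| ≥ |θ|/π. The angular power is then -c2 = -1 + s/2 and the radial one a - s - c1 = -1 + s/2,
  -- both integrable.
  set c1 : ℝ := a + 1 - 3 / 2 * s with hc1
  set c2 : ℝ := 1 - s / 2 with hc2
  have hc1' : 0 ≤ c1 := by linarith
  have hc2' : 0 ≤ c2 := by linarith
  set M : ℝ := Real.pi⁻¹ * (a + 1) * 2 ^ c1 * Real.pi ^ c2 with hM
  have hMpos : 0 ≤ M := by positivity
  rw [lintegral_discMeasure, ← lintegral_indicator measurableSet_ball,
    ← Complex.lintegral_comp_polarCoord_symm]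
  set A : ℝ → ℝ≥0∞ := fun r => ENNReal.ofReal (r * (1 - r ^ 2) ^ (-1 + s / 2)) with hA
  set B : ℝ → ℝ≥0∞ := fun θ => ENNReal.ofReal (|θ| ^ (-c2)) with hB
  have hAm : Measurable A := by fun_prop
  have hBm : Measurable B := by fun_prop
  have hbound : ∀ x ∈ polarCoord.target, x.2 ≠ 0 → ENNReal.ofReal x.1 •
      (Metric.ball (0 : ℂ) 1).indicator (fun z => ENNReal.ofReal (discDensity a z) *
        ENNReal.ofReal ((1 - ‖z‖ ^ 2) ^ (-s) * ‖1 - z‖ ^ (-(a + 2 - 2 * s))))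
        (Complex.polarCoord.symm x) ≤
      (Set.Ioo (0 : ℝ) 1 ×ˢ Set.Ioo (-Real.pi) Real.pi).indicator
        (fun x => ENNReal.ofReal M * (A x.1 * B x.2)) x := by
    rintro ⟨r, θ⟩ hx hθ0
    rw [polarCoord_target, Set.mem_prod] at hx
    obtain ⟨hr, hθ⟩ := hx
    simp only [Set.mem_Ioi] at hr hθ
    have hnorm : ‖Complex.polarCoord.symm (r, θ)‖ = r := by
      rw [Complex.norm_polarCoord_symm]
      exact abs_of_pos hr
    by_cases hr1 : r < 1
    swap
    · rw [Set.indicator_of_notMem, smul_zero]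
      · exact zero_le
      · rwa [mem_ball_zero_iff, hnorm]
    rw [Set.indicator_of_mem (by rwa [mem_ball_zero_iff, hnorm]),
      Set.indicator_of_mem (by exact ⟨⟨hr, hr1⟩, hθ⟩), hnorm, discDensity, hnorm]
    have h1r : 0 < 1 - r ^ 2 := by nlinarith
    have hθ' : |θ| ≤ Real.pi := abs_le.2 ⟨hθ.1.le, hθ.2.le⟩
    simp only [hA, hB]
    have hA0 : 0 ≤ r * (1 - r ^ 2) ^ (-1 + s / 2) := by positivity
    rw [← ENNReal.ofReal_mul (by positivity), ← ENNReal.ofReal_mul hA0,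
      ← ENNReal.ofReal_mul hMpos, smul_eq_mul, ← ENNReal.ofReal_mul hr.le]
    refine ENNReal.ofReal_le_ofReal ?_
    set N := ‖1 - Complex.polarCoord.symm (r, θ)‖ with hN
    have hN1 : (1 - r ^ 2) / 2 ≤ N := by
      have := norm_sub_norm_le (1 : ℂ) (Complex.polarCoord.symm (r, θ))
      rw [norm_one, hnorm] at this
      nlinarith
    have hN2 : |θ| / Real.pi ≤ N := by
      rw [hN, Complex.polarCoord_symm_apply]
      exact abs_div_pi_le_norm_one_sub hr.le hθ'
    have hNpos : 0 < N := lt_of_lt_of_le (by positivity) hN1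
    have hθpos : 0 < |θ| := abs_pos.2 hθ0
    have hNc : N ^ (-(a + 2 - 2 * s)) ≤
        ((1 - r ^ 2) ^ (-c1) * 2 ^ c1) * (|θ| ^ (-c2) * Real.pi ^ c2) := by
      have : -(a + 2 - 2 * s) = -c1 + -c2 := by
        rw [hc1, hc2]
        ring
      rw [this, Real.rpow_add hNpos]
      have e1 : ((1 - r ^ 2) / 2) ^ (-c1) = (1 - r ^ 2) ^ (-c1) * 2 ^ c1 := by
        rw [Real.div_rpow h1r.le zero_le_two, Real.rpow_neg zero_le_two, div_inv_eq_mul]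
      have e2 : (|θ| / Real.pi) ^ (-c2) = |θ| ^ (-c2) * Real.pi ^ c2 := by
        rw [Real.div_rpow hθpos.le hpi.le, Real.rpow_neg hpi.le, div_inv_eq_mul]
      rw [← e1, ← e2]
      refine mul_le_mul (Real.rpow_le_rpow_of_nonpos (by positivity) hN1 (by linarith))
        (Real.rpow_le_rpow_of_nonpos (by positivity) hN2 (by linarith)) (by positivity)
        (by positivity)
    have hpow : (1 - r ^ 2) ^ a * (1 - r ^ 2) ^ (-s) * (1 - r ^ 2) ^ (-c1) =
        (1 - r ^ 2) ^ (-1 + s / 2) := by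
      rw [← Real.rpow_add h1r, ← Real.rpow_add h1r]
      congr 1
      rw [hc1]
      ring
    calc _ ≤ r * (Real.pi⁻¹ * ((a + 1) * (1 - r ^ 2) ^ a) * ((1 - r ^ 2) ^ (-s) *
          (((1 - r ^ 2) ^ (-c1) * 2 ^ c1) * (|θ| ^ (-c2) * Real.pi ^ c2)))) := by gcongr
      _ = M * (r * ((1 - r ^ 2) ^ a * (1 - r ^ 2) ^ (-s) * (1 - r ^ 2) ^ (-c1)) *
          |θ| ^ (-c2)) := by
          rw [hM]
          ring
      _ = _ := by rw [hpow]
  -- The ray θ = 0 is discarded because `0 ^ (-c2)` has the default value 0, which would spoil the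
  -- upper bound.
  have hae : ∀ᵐ x : ℝ × ℝ, x.2 ≠ 0 :=
    (Measure.quasiMeasurePreserving_snd (μ := (volume : Measure ℝ))
      (ν := (volume : Measure ℝ))).ae (Measure.ae_ne volume 0)
  refine lt_of_le_of_lt (setLIntegral_mono_ae' polarCoord.open_target.measurableSet
    (hae.mono fun x hx hxt => hbound x hxt hx)) ?_
  refine lt_of_le_of_lt (setLIntegral_le_lintegral _ _) ?_
  have hABm : Measurable fun x : ℝ × ℝ => A x.1 * B x.2 := by fun_prop
  rw [lintegral_indicator (measurableSet_Ioo.prod measurableSet_Ioo),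
    lintegral_const_mul _ hABm,
    Measure.volume_eq_prod, ← Measure.prod_restrict,
    lintegral_prod_mul hAm.aemeasurable hBm.aemeasurable]
  exact ENNReal.mul_lt_top ENNReal.ofReal_lt_top (ENNReal.mul_lt_top
    (lintegral_one_sub_sq_rpow_lt_top (by linarith)) (lintegral_abs_rpow_lt_top (by linarith) _))

/-- With c = z̄/|z|, the change |1 - cζ| - |1 - z̄ζ| is at most (1 - |z|)|ζ| ≤ 1 - |z||ζ| ≤ |1 -
z̄ζ|. This replaces z by a boundary point, so that by rotation invariance a single model integral
serves all z. -/
theorem exists_norm_eq_one_half_le {z : ℂ} (hz : ‖z‖ < 1) :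
    ∃ c : ℂ, ‖c‖ = 1 ∧ ∀ ζ : ℂ, ‖ζ‖ < 1 → ‖1 - c * ζ‖ / 2 ≤ ‖1 - conj z * ζ‖ := by
  obtain ⟨c, hc, hcz⟩ : ∃ c : ℂ, ‖c‖ = 1 ∧ conj z = ‖z‖ * c := by
    rcases eq_or_ne z 0 with rfl | h
    · exact ⟨1, by simp, by simp⟩
    · have h' : (‖z‖ : ℂ) ≠ 0 := by exact_mod_cast norm_ne_zero_iff.2 h
      refine ⟨conj z / ‖z‖, ?_, ?_⟩
      · rw [norm_div, Complex.norm_conj, Complex.norm_real, norm_norm,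
          div_self (norm_ne_zero_iff.2 h)]
      · field_simp
  refine ⟨c, hc, fun ζ hζ => ?_⟩
  have h1 : ‖1 - c * ζ‖ ≤ ‖1 - conj z * ζ‖ + (1 - ‖z‖) * ‖ζ‖ := by
    have : 1 - c * ζ = (1 - conj z * ζ) - ((1 - ‖z‖ : ℝ) : ℂ) * (c * ζ) := by
      rw [hcz]
      push_cast
      ring
    rw [this]
    refine (norm_sub_le _ _).trans ?_
    rw [norm_mul, norm_mul, hc, one_mul, Complex.norm_real,
      Real.norm_of_nonneg (by linarith)]
  have h2 : 1 - ‖z‖ * ‖ζ‖ ≤ ‖1 - conj z * ζ‖ := by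
    have := norm_sub_norm_le (1 : ℂ) (conj z * ζ)
    rwa [norm_one, norm_mul, Complex.norm_conj] at this
  nlinarith [norm_nonneg z, norm_nonneg ζ]

/-- The Forelli–Rudin estimate of the disc. -/
theorem exists_lintegral_discKernel_le {a s : ℝ} (hs : 0 < s) (hs1 : s ≤ 1)
    (hsa : 2 * s ≤ a + 1) : ∃ C : ℝ≥0, ∀ z : ℂ, ‖z‖ < 1 →
      ∫⁻ w, ‖discKernel a z w‖ₑ * ENNReal.ofReal ((1 - ‖w‖ ^ 2) ^ (-s)) ∂discMeasure a ≤
        C * ENNReal.ofReal ((1 - ‖z‖ ^ 2) ^ (-s)) := by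
  set c : ℝ := a + 2 - 2 * s with hc
  have hcpos : 0 < c := by linarith
  set I := ∫⁻ z, ENNReal.ofReal ((1 - ‖z‖ ^ 2) ^ (-s) * ‖1 - z‖ ^ (-c)) ∂discMeasure a with hI
  have hIfin : I < ∞ := lintegral_one_sub_rpow_lt_top hs hs1 hsa
  refine ⟨(ENNReal.ofReal (2 ^ c) * I).toNNReal, fun z hz => ?_⟩
  rw [ENNReal.coe_toNNReal (ENNReal.mul_lt_top ENNReal.ofReal_lt_top hIfin).ne,
    lintegral_discMeasure_comp_moebius a hz]
  obtain ⟨e, he, hle⟩ := exists_norm_eq_one_half_le hz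
  have hzpos := one_sub_norm_sq_pos hz
  -- After the substitution, weight times kernel has modulus |1 - z̄ζ|^{-(a+2)}, while (1 -
  -- |φ_z(ζ)|²)^{-s} contributes (1 - |z|²)^{-s} (1 - |ζ|²)^{-s} |1 - z̄ζ|^{2s}. The factor
  -- depending on z alone is the asserted growth.
  have hpt : ∀ᵐ ζ ∂discMeasure a, ENNReal.ofReal (moebiusWeight a z ζ) *
      (‖discKernel a z (moebius z ζ)‖ₑ * ENNReal.ofReal ((1 - ‖moebius z ζ‖ ^ 2) ^ (-s))) ≤
      ENNReal.ofReal ((1 - ‖z‖ ^ 2) ^ (-s)) * ENNReal.ofReal (2 ^ c) *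
        ENNReal.ofReal ((1 - ‖e * ζ‖ ^ 2) ^ (-s) * ‖1 - e * ζ‖ ^ (-c)) := by
    have hne : ∀ᵐ ζ ∂discMeasure a, 1 - e * ζ ≠ 0 := by
      filter_upwards [ae_discMeasure_norm_lt_one a] with ζ hζ h
      have : ‖e * ζ‖ = 1 := by rw [← sub_eq_zero.1 h, norm_one]
      rw [norm_mul, he, one_mul] at this
      exact hζ.ne this
    filter_upwards [ae_discMeasure_norm_lt_one a, hne] with ζ hζ hne
    have hζpos := one_sub_norm_sq_pos hζ
    have hN : 0 < ‖1 - conj z * ζ‖ := norm_pos_iff.2 (one_sub_conj_mul_ne_zero hz hζ)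
    have hN' : 0 < ‖1 - e * ζ‖ := norm_pos_iff.2 hne
    rw [← ofReal_norm, ← ENNReal.ofReal_mul (norm_nonneg _),
      ← ENNReal.ofReal_mul (moebiusWeight_nonneg hz ζ), ← ENNReal.ofReal_mul (by positivity),
      ← ENNReal.ofReal_mul (by positivity)]
    refine ENNReal.ofReal_le_ofReal ?_
    have h1 := congrArg norm (moebiusWeight_mul_discKernel a hz hζ)
    rw [norm_mul, Complex.norm_real, Real.norm_of_nonneg (moebiusWeight_nonneg hz ζ),
      norm_discKernel a hζ hz, mul_comm ζ] at h1
    have h2 : (1 - ‖moebius z ζ‖ ^ 2) ^ (-s) =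
        (1 - ‖z‖ ^ 2) ^ (-s) * (1 - ‖ζ‖ ^ 2) ^ (-s) * ‖1 - conj z * ζ‖ ^ (2 * s) := by
      rw [one_sub_norm_moebius_sq hz hζ, Real.div_rpow (by positivity) (by positivity),
        Real.mul_rpow hzpos.le hζpos.le, ← Real.rpow_natCast_mul hN.le, Nat.cast_ofNat, mul_neg,
        Real.rpow_neg hN.le, div_inv_eq_mul]
    have h3 : (‖1 - conj z * ζ‖ ^ (a + 2))⁻¹ * ‖1 - conj z * ζ‖ ^ (2 * s) =
        ‖1 - conj z * ζ‖ ^ (-c) := by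
      rw [← Real.rpow_neg hN.le, ← Real.rpow_add hN]
      congr 1
      rw [hc]
      ring
    have h4 : ‖1 - conj z * ζ‖ ^ (-c) ≤ 2 ^ c * ‖1 - e * ζ‖ ^ (-c) := by
      have := Real.rpow_le_rpow_of_nonpos (by positivity) (hle ζ hζ) (by linarith : -c ≤ 0)
      rwa [Real.div_rpow hN'.le zero_le_two, Real.rpow_neg zero_le_two, div_inv_eq_mul,
        mul_comm (‖1 - e * ζ‖ ^ (-c))] at this
    rw [norm_mul e ζ, he, one_mul, ← mul_assoc, h1, h2]
    calc _ = (1 - ‖z‖ ^ 2) ^ (-s) * (1 - ‖ζ‖ ^ 2) ^ (-s) *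
          ((‖1 - conj z * ζ‖ ^ (a + 2))⁻¹ * ‖1 - conj z * ζ‖ ^ (2 * s)) := by ring
      _ ≤ (1 - ‖z‖ ^ 2) ^ (-s) * (1 - ‖ζ‖ ^ 2) ^ (-s) * (2 ^ c * ‖1 - e * ζ‖ ^ (-c)) := by
          rw [h3]
          gcongr
      _ = _ := by ring
  have hm : Measurable fun ζ : ℂ =>
      ENNReal.ofReal ((1 - ‖ζ‖ ^ 2) ^ (-s) * ‖1 - ζ‖ ^ (-c)) := by fun_prop
  have hm' : Measurable fun ζ : ℂ =>
      ENNReal.ofReal ((1 - ‖e * ζ‖ ^ 2) ^ (-s) * ‖1 - e * ζ‖ ^ (-c)) := by fun_prop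
  refine (lintegral_mono_ae hpt).trans ?_
  rw [lintegral_const_mul _ hm', (measurePreserving_mul_discMeasure a he).lintegral_comp hm]
  exact le_of_eq (by ring)

theorem lintegral_weightedMeasure_prod {n : ℕ} {α : Fin n → ℝ} (hα : ∀ j, -1 < α j)
    {F : Fin n → ℂ → ℝ≥0∞} (hF : ∀ j, Measurable (F j)) :
    ∫⁻ z, ∏ j, F j (z j) ∂weightedMeasure α = ∏ j, ∫⁻ x, F j x ∂discMeasure (α j) := by
  have := fun j => isProbabilityMeasure_discMeasure (hα j)
  have h := ProbabilityTheory.lintegral_prod_eq_prod_lintegral_of_indepFun Finset.univ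
    (fun (j : Fin n) (z : Fin n → ℂ) => F j (z j))
    (ProbabilityTheory.iIndepFun_pi (μ := fun j => discMeasure (α j)) (X := F)
      fun j => (hF j).aemeasurable) (fun j => (hF j).comp (measurable_pi_apply j))
  rw [weightedMeasure, h]
  exact Finset.prod_congr rfl fun j _ =>
    (measurePreserving_eval (fun j => discMeasure (α j)) j).lintegral_comp (hF j)

/-- The Forelli–Rudin estimate of the polydisc. -/
theorem exists_lintegral_kernel_le {n : ℕ} {α : Fin n → ℝ} {s : Fin n → ℝ} (hs : ∀ j, 0 < s j)
    (hs1 : ∀ j, s j ≤ 1) (hsa : ∀ j, 2 * s j ≤ α j + 1) : ∃ C : ℝ≥0, ∀ z ∈ polydisc n,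
      ∫⁻ w, ‖kernel α z w‖ₑ * ∏ j, ENNReal.ofReal ((1 - ‖w j‖ ^ 2) ^ (-s j)) ∂weightedMeasure α ≤
        C * ∏ j, ENNReal.ofReal ((1 - ‖z j‖ ^ 2) ^ (-s j)) := by
  have hα : ∀ j, -1 < α j := fun j => by linarith [hs j, hsa j]
  choose C hC using fun j => exists_lintegral_discKernel_le (hs j) (hs1 j) (hsa j)
  refine ⟨∏ j, C j, fun z hz => ?_⟩
  have h1 : ∀ w : Fin n → ℂ,
      ‖kernel α z w‖ₑ * ∏ j, ENNReal.ofReal ((1 - ‖w j‖ ^ 2) ^ (-s j)) =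
      ∏ j, ‖discKernel (α j) (z j) (w j)‖ₑ * ENNReal.ofReal ((1 - ‖w j‖ ^ 2) ^ (-s j)) := by
    intro w
    rw [Finset.prod_mul_distrib]
    congr 1
    simp only [← ofReal_norm]
    rw [kernel_eq_prod, norm_prod, ENNReal.ofReal_prod_of_nonneg fun _ _ => norm_nonneg _]
  simp only [h1]
  rw [lintegral_weightedMeasure_prod hα
    (F := fun j x => ‖discKernel (α j) (z j) x‖ₑ * ENNReal.ofReal ((1 - ‖x‖ ^ 2) ^ (-s j))),
    ENNReal.ofNNReal_finsetProd, ← Finset.prod_mul_distrib]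
  · exact Finset.prod_le_prod' fun j _ => hC j (z j) (hz j)
  · intro j
    have h2 := (measurable_discKernel (α j)).comp (measurable_prodMk_left (x := z j))
    have h3 : Measurable fun x : ℂ => ENNReal.ofReal ((1 - ‖x‖ ^ 2) ^ (-s j)) := by fun_prop
    exact h2.enorm.mul h3

/-- The absolute Bergman projection is bounded on `Lᵖ`. -/
theorem exists_lintegral_kernel_rpow_le {n : ℕ} {α : Fin n → ℝ} (hα : ∀ j, -1 < α j) {p q : ℝ}
    (hpq : p.HolderConjugate q) : ∃ C : ℝ≥0, ∀ ψ : (Fin n → ℂ) → ℝ≥0∞, Measurable ψ →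
      ∫⁻ z, (∫⁻ w, ‖kernel α z w‖ₑ * ψ w ∂weightedMeasure α) ^ p ∂weightedMeasure α ≤
        (C : ℝ≥0∞) ^ p * ∫⁻ w, ψ w ^ p ∂weightedMeasure α := by
  have hp := hpq.pos
  have hq := hpq.symm.pos
  have := isProbabilityMeasure_weightedMeasure hα
  -- The Schur test function is ∏ⱼ (1 - |zⱼ|²)^{-tⱼ}. Both s = tq and s = tp must satisfy 0 < s ≤ 1
  -- and 2s ≤ α + 1; as p and q are below p + q, this t serves both.
  set t : Fin n → ℝ := fun j => min 1 (α j + 1) / (2 * (p + q)) with ht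
  have hmin : ∀ j, 0 < min 1 (α j + 1) := fun j =>
    lt_min one_pos (by linarith [hα j])
  have htpos : ∀ j, 0 < t j := fun j => div_pos (hmin j) (by positivity)
  have key : ∀ r : ℝ, 0 < r → r ≤ p + q → ∀ j, 0 < t j * r ∧ t j * r ≤ 1 ∧
      2 * (t j * r) ≤ α j + 1 := by
    intro r hr hrle j
    have h1 : 2 * (t j * r) ≤ min 1 (α j + 1) := by
      calc 2 * (t j * r) ≤ 2 * (t j * (p + q)) := by
            gcongr
            exact (htpos j).le
        _ = _ := by
            rw [ht]
            field_simp
    refine ⟨mul_pos (htpos j) hr, ?_, h1.trans (min_le_right _ _)⟩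
    have := h1.trans (min_le_left _ _)
    linarith [mul_pos (htpos j) hr]
  have hkq := key q hq (by linarith)
  have hkp := key p hp (by linarith)
  obtain ⟨C1, hC1⟩ := exists_lintegral_kernel_le (fun j => (hkq j).1) (fun j => (hkq j).2.1)
    fun j => (hkq j).2.2
  obtain ⟨C2, hC2⟩ := exists_lintegral_kernel_le (fun j => (hkp j).1) (fun j => (hkp j).2.1)
    fun j => (hkp j).2.2
  set h : (Fin n → ℂ) → ℝ≥0∞ := fun z => ∏ j, ENNReal.ofReal ((1 - ‖z j‖ ^ 2) ^ (-t j)) with hh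
  have hpow : ∀ z ∈ polydisc n, ∀ r : ℝ, 0 < r →
      h z ^ r = ∏ j, ENNReal.ofReal ((1 - ‖z j‖ ^ 2) ^ (-(t j * r))) := by
    intro z hz r hr
    rw [hh]
    simp only
    rw [← ENNReal.prod_rpow_of_nonneg hr.le]
    refine Finset.prod_congr rfl fun j _ => ?_
    have hpos := one_sub_norm_sq_pos (hz j)
    rw [ENNReal.ofReal_rpow_of_nonneg (by positivity) hr.le, ← Real.rpow_mul hpos.le, neg_mul]
  have hae := ae_weightedMeasure_mem_polydisc hα
  have hm : Measurable h := by
    rw [hh]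
    fun_prop
  refine ⟨max C1 C2, fun ψ hψ => ?_⟩
  refine lintegral_rpow_lintegral_le_of_schur hpq (k := fun z w => ‖kernel α z w‖ₑ)
    (measurable_kernel α).enorm hm ?_ ?_ _ ?_ ?_ hψ
  · filter_upwards [hae] with z hz
    refine Finset.prod_ne_zero_iff.2 fun j _ => ?_
    have hpos := one_sub_norm_sq_pos (hz j)
    simpa using Real.rpow_pos_of_pos hpos _
  · exact Filter.Eventually.of_forall fun z => ENNReal.prod_ne_top fun j _ => ENNReal.ofReal_ne_top
  · filter_upwards [hae] with z hz
    rw [hpow z hz q hq]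
    refine le_trans (le_of_eq (lintegral_congr_ae ?_)) ((hC1 z hz).trans ?_)
    · filter_upwards [hae] with w hw
      rw [hpow w hw q hq]
    · gcongr
      exact le_max_left _ _
  · filter_upwards [hae] with w hw
    rw [hpow w hw p hp]
    refine le_trans (le_of_eq (lintegral_congr_ae ?_)) ((hC2 w hw).trans ?_)
    · filter_upwards [hae] with z hz
      rw [hpow z hz p hp, ← conj_kernel α hz hw]
      simp only [← ofReal_norm, Complex.norm_conj]
    · gcongr
      exact le_max_right _ _

/-! ### Expansion of the reciprocal kernel -/

theorem choose_succ_mul (b : ℂ) (k : ℕ) :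
    Ring.choose b (k + 1) * (k + 1) = Ring.choose b k * (b - k) := by
  rw [Ring.choose_eq_smul, Ring.choose_eq_smul, descPochhammer_succ_right,
    Polynomial.smeval_mul, Polynomial.smeval_sub, Polynomial.smeval_X, Polynomial.smeval_natCast,
    Nat.factorial_succ]
  have h1 : ((k : ℂ) + 1) ≠ 0 := by exact_mod_cast Nat.succ_ne_zero k
  have h2 : (k.factorial : ℂ) ≠ 0 := by exact_mod_cast k.factorial_ne_zero
  simp only [smul_eq_mul, pow_one, pow_zero, nsmul_eq_mul, mul_one]
  push_cast
  field_simp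

/-- Beyond k ≥ b the recursion becomes b uₖ = k uₖ - (k+1) uₖ₊₁ for uₖ = |choose(b, k)|, so the
partial sums telescope and stay bounded. Absolute convergence up to |x| = 1 is what makes the final
constant independent of w. -/
theorem summable_norm_choose {b : ℝ} (hb : 0 < b) :
    Summable fun k : ℕ => ‖Ring.choose (b : ℂ) k‖ := by
  set u : ℕ → ℝ := fun k => ‖Ring.choose (b : ℂ) k‖ with hu
  set K := ⌈b⌉₊ with hK
  have hrec : ∀ k : ℕ, K ≤ k → b * u k = k * u k - (k + 1) * u (k + 1) := by
    intro k hk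
    have h := congrArg norm (choose_succ_mul (b : ℂ) k)
    have hbk : b ≤ k := (Nat.le_ceil b).trans (by exact_mod_cast hk)
    have e1 : ‖(k : ℂ) + 1‖ = k + 1 := by
      exact_mod_cast Complex.norm_natCast (k + 1)
    have e2 : ‖(b : ℂ) - k‖ = k - b := by
      rw [show (b : ℂ) - k = ((b - k : ℝ) : ℂ) by push_cast; rfl, Complex.norm_real,
        Real.norm_of_nonpos (by linarith)]
      ring
    rw [norm_mul, norm_mul, e1, e2] at h
    simp only [hu]
    linarith
  have htel : ∀ N : ℕ, b * ∑ k ∈ Finset.range N, u (k + K) =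
      K * u K - (N + K : ℕ) * u (N + K) := by
    intro N
    induction N with
    | zero => simp
    | succ N ih =>
      rw [Finset.sum_range_succ, mul_add, ih, hrec (N + K) (by omega),
        show N + 1 + K = N + K + 1 by ring]
      push_cast
      ring
  rw [← summable_nat_add_iff K]
  refine summable_of_sum_range_le (c := K * u K / b) (fun _ => norm_nonneg _) fun N => ?_
  rw [le_div_iff₀ hb, mul_comm, htel N]
  have : 0 ≤ ((N + K : ℕ) : ℝ) * u (N + K) := by positivity
  linarith

/-- The coefficients of the expansion of `(1 - x) ^ b`. -/
def powCoeff (b : ℝ) (k : ℕ) : ℂ := (-1) ^ k * Ring.choose (b : ℂ) k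

theorem summable_norm_powCoeff {b : ℝ} (hb : 0 < b) : Summable fun k => ‖powCoeff b k‖ := by
  simpa [powCoeff] using summable_norm_choose hb

theorem hasSum_powCoeff (b : ℝ) {x : ℂ} (hx : ‖x‖ < 1) :
    HasSum (fun k => powCoeff b k * x ^ k) ((1 - x) ^ (b : ℂ)) := by
  have h := (Complex.one_add_cpow_hasFPowerSeriesOnBall_zero (a := (b : ℂ))).hasSum (y := -x)
    (by simpa [Metric.mem_eball, edist_zero_right, enorm_eq_nnnorm, ← NNReal.coe_lt_one] using hx)
  rw [zero_add, ← sub_eq_add_neg] at h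
  have e : (fun k => powCoeff b k * x ^ k) =
      fun k => binomialSeries ℂ (b : ℂ) k fun _ => -x := by
    funext k
    rw [binomialSeries_apply, List.ofFn_const, List.prod_replicate, smul_eq_mul, powCoeff, neg_pow]
    ring
  rw [e]
  exact h

theorem hasSum_prod_fin {n : ℕ} {a : Fin n → ℕ → ℂ} {A : Fin n → ℂ}
    (hs : ∀ j, Summable fun k => ‖a j k‖) (hA : ∀ j, HasSum (a j) (A j)) :
    (Summable fun k : Fin n → ℕ => ‖∏ j, a j (k j)‖) ∧
      HasSum (fun k : Fin n → ℕ => ∏ j, a j (k j)) (∏ j, A j) := by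
  induction n with
  | zero =>
    refine ⟨Summable.of_finite, ?_⟩
    simp
  | succ n ih =>
    obtain ⟨h1, h2⟩ := ih (fun j => hs j.succ) fun j => hA j.succ
    rw [← (Fin.consEquiv fun _ : Fin (n + 1) => ℕ).summable_iff,
      ← (Fin.consEquiv fun _ : Fin (n + 1) => ℕ).hasSum_iff]
    simp only [Function.comp_def, Fin.consEquiv_apply, Fin.prod_univ_succ, Fin.cons_zero,
      Fin.cons_succ]
    have h3 := Summable.mul_norm (f := a 0)
      (g := fun k : Fin n → ℕ => ∏ j : Fin n, a j.succ (k j)) (hs 0) h1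
    have h4 := HasSum.mul (hA 0) h2 h3.of_norm
    exact ⟨h3, h4⟩

/-! ### Projections of compactly supported functions -/

theorem measurable_kernel_left {n : ℕ} (α : Fin n → ℝ) (z : Fin n → ℂ) :
    Measurable fun v => kernel α z v := by
  have h := (measurable_kernel α).comp (measurable_prodMk_left (x := z))
  exact h

theorem norm_mul_kernel_le {n : ℕ} {α : Fin n → ℝ} (hα : ∀ j, -1 < α j)
    {θ : (Fin n → ℂ) → ℂ} {M r : ℝ} (hM : 0 ≤ M) (hθM : ∀ v, ‖θ v‖ ≤ M) (hr : r < 1)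
    (hsupp : ∀ v, r < ‖v‖ → θ v = 0) {z : Fin n → ℂ} (hz : z ∈ polydisc n) (v : Fin n → ℂ) :
    ‖θ v * kernel α z v‖ ≤ M * ∏ j, ((1 - r) ^ (α j + 2))⁻¹ := by
  have h1r : 0 < 1 - r := by linarith
  rcases lt_or_ge r ‖v‖ with h | h
  · rw [hsupp v h, zero_mul, norm_zero]
    exact mul_nonneg hM (Finset.prod_nonneg fun j _ => by positivity)
  · rw [norm_mul]
    exact mul_le_mul (hθM v) (norm_kernel_le hα hr hz h) (norm_nonneg _) hM

theorem integrable_mul_kernel_of_bounded {n : ℕ} {α : Fin n → ℝ} (hα : ∀ j, -1 < α j)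
    {θ : (Fin n → ℂ) → ℂ} (hθ : Measurable θ) {M r : ℝ} (hM : 0 ≤ M) (hθM : ∀ v, ‖θ v‖ ≤ M)
    (hr : r < 1) (hsupp : ∀ v, r < ‖v‖ → θ v = 0) {z : Fin n → ℂ} (hz : z ∈ polydisc n) :
    Integrable (fun v => θ v * kernel α z v) (weightedMeasure α) := by
  have := isProbabilityMeasure_weightedMeasure hα
  exact Integrable.of_bound (hθ.mul (measurable_kernel_left α z)).aestronglyMeasurable _
    (Filter.Eventually.of_forall (norm_mul_kernel_le hα hM hθM hr hsupp hz))

/-- With the support inside a smaller ball the kernel is bounded uniformly in z, and differentiation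
under the integral sign applies. Such projections therefore lie in the domain of the Toeplitz
product. -/
theorem isBoundedHolomorphic_bergmanProjection {n : ℕ} {α : Fin n → ℝ} (hα : ∀ j, -1 < α j)
    {θ : (Fin n → ℂ) → ℂ} (hθ : Measurable θ) {M r : ℝ} (hM : 0 ≤ M) (hθM : ∀ v, ‖θ v‖ ≤ M)
    (hr : r < 1) (hsupp : ∀ v, r < ‖v‖ → θ v = 0) :
    IsBoundedHolomorphic (bergmanProjection α θ) := by
  have hprob := isProbabilityMeasure_weightedMeasure hα
  set B : ℝ := ∏ j, ((1 - r) ^ (α j + 2))⁻¹ with hB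
  refine ⟨fun z₀ hz₀ => ?_, M * B, fun z hz => ?_⟩
  swap
  · refine (norm_integral_le_of_norm_le_const (Filter.Eventually.of_forall
      (norm_mul_kernel_le hα hM hθM hr hsupp hz))).trans ?_
    simp [hB]
  set ε : ℝ := (1 - ‖z₀‖) / 2 with hε
  have hεpos : 0 < ε := by linarith [norm_lt_one_of_mem_polydisc hz₀]
  have hsub : ∀ z ∈ Metric.ball z₀ ε, Metric.ball z ε ⊆ polydisc n := by
    intro z hz x hx
    refine mem_polydisc_of_norm_lt_one ?_
    rw [mem_ball_iff_norm] at hz hx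
    calc ‖x‖ = ‖(x - z) + (z - z₀) + z₀‖ := by congr 1; abel
      _ ≤ ‖x - z‖ + ‖z - z₀‖ + ‖z₀‖ := norm_add₃_le
      _ < 1 := by linarith
  have hmem : ∀ z ∈ Metric.ball z₀ ε, z ∈ polydisc n := fun z hz =>
    hsub z hz (Metric.mem_ball_self hεpos)
  have hder : ∀ v, ∀ z ∈ Metric.ball z₀ ε, HasFDerivAt (fun z => θ v * kernel α z v)
      (θ v • kernelDeriv α z v) z := by
    intro v z hz
    rcases lt_or_ge r ‖v‖ with h | h
    · have e : θ v • kernelDeriv α z v = 0 := by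
        ext x
        simp [hsupp v h]
      rw [e]
      simp only [hsupp v h, zero_mul]
      exact hasFDerivAt_const (0 : ℂ) z
    · exact (hasFDerivAt_kernel α (hmem z hz)
        (mem_polydisc_of_norm_lt_one (h.trans_lt hr))).const_mul _
  -- A Cauchy-type estimate on the ball of radius ε about z, which still lies in the polydisc; on it
  -- the values differ from the central one by at most 2MB.
  have hbound : ∀ v, ∀ z ∈ Metric.ball z₀ ε, ‖θ v • kernelDeriv α z v‖ ≤ M * B * 2 / ε := by
    intro v z hz
    rw [← (hder v z hz).fderiv]
    have hd : DifferentiableOn ℂ (fun z => θ v * kernel α z v) (Metric.ball z ε) := by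
      rcases lt_or_ge r ‖v‖ with h | h
      · simp only [hsupp v h, zero_mul]
        exact differentiableOn_const _
      · exact ((differentiableOn_kernel α
          (mem_polydisc_of_norm_lt_one (h.trans_lt hr))).mono (hsub z hz)).const_mul _
    refine Complex.norm_fderiv_le_div_of_mapsTo_ball hd (fun x hx => ?_) hεpos
    rw [mem_closedBall_iff_norm]
    have h1 := norm_mul_kernel_le hα hM hθM hr hsupp (hsub z hz hx) v
    have h2 := norm_mul_kernel_le hα hM hθM hr hsupp (hmem z hz) v
    refine (norm_sub_le _ _).trans ?_
    linarith
  have h := hasFDerivAt_integral_of_dominated_of_fderiv_le (𝕜 := ℂ) (μ := weightedMeasure α)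
    (F := fun z v => θ v * kernel α z v) (F' := fun z v => θ v • kernelDeriv α z v)
    (bound := fun _ => M * B * 2 / ε) (Metric.ball_mem_nhds z₀ hεpos)
    (Filter.Eventually.of_forall fun z => (hθ.mul (measurable_kernel_left α z)).aestronglyMeasurable)
    (integrable_mul_kernel_of_bounded hα hθ hM hθM hr hsupp hz₀)
    (hθ.smul (measurable_kernelDeriv α z₀)).aestronglyMeasurable
    (Filter.Eventually.of_forall hbound) (integrable_const _) (Filter.Eventually.of_forall hder)
  exact h.differentiableAt.differentiableWithinAt

/-! ### Toeplitz operators on projections of compactly supported functions -/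

theorem aestronglyMeasurable_of_differentiableOn {n : ℕ} {α : Fin n → ℝ} (hα : ∀ j, -1 < α j)
    {F : (Fin n → ℂ) → ℂ} (hF : DifferentiableOn ℂ F (polydisc n)) :
    AEStronglyMeasurable F (weightedMeasure α) := by
  rw [← Measure.restrict_eq_self_of_ae_mem (ae_weightedMeasure_mem_polydisc hα)]
  exact hF.continuousOn.aestronglyMeasurable (isOpen_polydisc n).measurableSet

theorem bergmanProjection_congr {n : ℕ} {α : Fin n → ℝ} (hα : ∀ j, -1 < α j)
    {φ ψ : (Fin n → ℂ) → ℂ} (h : ∀ z ∈ polydisc n, φ z = ψ z) :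
    bergmanProjection α φ = bergmanProjection α ψ := by
  ext w
  refine integral_congr_ae ?_
  filter_upwards [ae_weightedMeasure_mem_polydisc hα] with z hz
  rw [h z hz]

/-- The product f B is holomorphic and integrable, so the projection fixes it. -/
theorem toeplitz_eq_mul {n : ℕ} {α : Fin n → ℝ} (hα : ∀ j, -1 < α j) {f B : (Fin n → ℂ) → ℂ}
    (hf : DifferentiableOn ℂ f (polydisc n)) (hfi : Integrable f (weightedMeasure α))
    (hB : IsBoundedHolomorphic B) {z : Fin n → ℂ} (hz : z ∈ polydisc n) :
    toeplitz α f B z = f z * B z := by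
  obtain ⟨hBd, M, hM⟩ := hB
  refine integral_mul_kernel hα (F := fun z => f z * B z) (hf.mul hBd) ?_ hz
  refine hfi.mul_bdd (c := M) (aestronglyMeasurable_of_differentiableOn hα hBd) ?_
  filter_upwards [ae_weightedMeasure_mem_polydisc hα] with z hz
  exact hM z hz

/-- After Fubini, the inner integral of ḡ(u) K(z, u) K(u, v) is the conjugate of the reproducing
formula for g K_z, hence equals conj(g(v)) K(z, v). The support of θ makes the double integral
absolutely convergent for merely integrable g. -/
theorem toeplitz_conj_bergmanProjection {n : ℕ} {α : Fin n → ℝ} (hα : ∀ j, -1 < α j)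
    {g : (Fin n → ℂ) → ℂ} (hg : DifferentiableOn ℂ g (polydisc n))
    (hgi : Integrable g (weightedMeasure α)) {θ : (Fin n → ℂ) → ℂ} (hθ : Measurable θ) {M r : ℝ}
    (hM : 0 ≤ M) (hθM : ∀ v, ‖θ v‖ ≤ M) (hr : r < 1) (hsupp : ∀ v, r < ‖v‖ → θ v = 0)
    {z : Fin n → ℂ} (hz : z ∈ polydisc n) :
    toeplitz α (fun z => conj (g z)) (bergmanProjection α θ) z =
      bergmanProjection α (fun v => θ v * conj (g v)) z := by
  have hprob := isProbabilityMeasure_weightedMeasure hα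
  have hae := ae_weightedMeasure_mem_polydisc hα
  have hgc : Integrable (fun u => conj (g u)) (weightedMeasure α) :=
    (Complex.conjLIE.toContinuousLinearEquiv.integrable_comp_iff).2 hgi
  have hint1 : Integrable (fun u => conj (g u) * kernel α z u) (weightedMeasure α) :=
    integrable_mul_kernel hα hgc hz
  have hm1 : Measurable fun x : (Fin n → ℂ) × (Fin n → ℂ) => θ x.2 * kernel α x.1 x.2 :=
    (hθ.comp measurable_snd).mul (measurable_kernel α)
  have hprod : Integrable (Function.uncurry fun u v : Fin n → ℂ =>
      conj (g u) * kernel α z u * (θ v * kernel α u v))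
      ((weightedMeasure α).prod (weightedMeasure α)) := by
    refine (hint1.comp_fst (weightedMeasure α)).mul_bdd
      (c := M * ∏ j, ((1 - r) ^ (α j + 2))⁻¹) hm1.aestronglyMeasurable ?_
    have h1 := (Measure.quasiMeasurePreserving_fst (μ := weightedMeasure α)
      (ν := weightedMeasure α)).ae hae
    filter_upwards [h1] with x hx
    exact norm_mul_kernel_le hα hM hθM hr hsupp hx x.2
  have h1 : toeplitz α (fun z => conj (g z)) (bergmanProjection α θ) z =
      ∫ u, ∫ v, conj (g u) * kernel α z u * (θ v * kernel α u v) ∂weightedMeasure α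
        ∂weightedMeasure α := by
    refine integral_congr_ae (Filter.Eventually.of_forall fun u => ?_)
    simp only
    rw [integral_const_mul, bergmanProjection]
    ring
  rw [h1, integral_integral_swap hprod]
  refine integral_congr_ae ?_
  filter_upwards [hae] with v hv
  have h2 : ∫ u, conj (g u) * kernel α z u * (θ v * kernel α u v) ∂weightedMeasure α =
      θ v * conj (∫ u, (g u * kernel α u z) * kernel α v u ∂weightedMeasure α) := by
    rw [← integral_conj, ← integral_const_mul]
    refine integral_congr_ae ?_
    filter_upwards [hae] with u hu
    rw [map_mul, map_mul, conj_kernel α hu hz, conj_kernel α hv hu]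
    ring
  have h3 : Integrable (fun u => g u * kernel α u z) (weightedMeasure α) := by
    refine (integrable_mul_kernel hα hgi hz).mono
      (hgi.1.mul (aestronglyMeasurable_of_differentiableOn hα (differentiableOn_kernel α hz))) ?_
    filter_upwards [hae] with u hu
    rw [norm_mul, norm_mul, ← conj_kernel α hz hu, Complex.norm_conj]
  rw [h2, integral_mul_kernel hα (F := fun u => g u * kernel α u z)
    (hg.mul (differentiableOn_kernel α hz)) h3 hv, map_mul, conj_kernel α hv hz]
  ring

/-- The Bergman projection is bounded on `Lᵖ`. -/
theorem exists_bergmanNorm_bergmanProjection_le {n : ℕ} {α : Fin n → ℝ} (hα : ∀ j, -1 < α j)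
    {p q : ℝ} (hpq : p.HolderConjugate q) : ∃ C : ℝ≥0, ∀ θ : (Fin n → ℂ) → ℂ, Measurable θ →
      bergmanNorm α p (bergmanProjection α θ) ≤ C * bergmanNorm α p θ := by
  obtain ⟨C, hC⟩ := exists_lintegral_kernel_rpow_le hα hpq
  have hp := hpq.pos
  refine ⟨C, fun θ hθ => ?_⟩
  have h0 : ENNReal.ofReal p ≠ 0 := by simpa using hp
  rw [bergmanNorm, bergmanNorm, eLpNorm_eq_lintegral_rpow_enorm_toReal h0 ENNReal.ofReal_ne_top,
    eLpNorm_eq_lintegral_rpow_enorm_toReal h0 ENNReal.ofReal_ne_top, ENNReal.toReal_ofReal hp.le]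
  calc _ ≤ ((C : ℝ≥0∞) ^ p * ∫⁻ v, ‖θ v‖ₑ ^ p ∂weightedMeasure α) ^ (1 / p) := by
        refine ENNReal.rpow_le_rpow (le_trans ?_ (hC _ hθ.enorm)) (by positivity)
        refine lintegral_mono fun z => ENNReal.rpow_le_rpow ?_ hp.le
        refine (enorm_integral_le_lintegral_enorm _).trans (le_of_eq ?_)
        refine lintegral_congr fun v => ?_
        rw [enorm_mul, mul_comm]
    _ = _ := by
        rw [ENNReal.mul_rpow_of_nonneg _ _ (by positivity), ← ENNReal.rpow_mul,
          mul_one_div_cancel hp.ne', ENNReal.rpow_one]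

/-- Minkowski's inequality for finite partial sums, followed by Fatou's lemma along a sequence of
finite sets; pointwise convergence is enough. -/
theorem eLpNorm_le_tsum_of_hasSum {X ι : Type*} [MeasurableSpace X] [Countable ι] {μ : Measure X}
    {p : ℝ≥0∞} (hp : 1 ≤ p) {F : ι → X → ℂ} {S : X → ℂ}
    (hF : ∀ i, AEStronglyMeasurable (F i) μ) (hS : ∀ᵐ x ∂μ, HasSum (fun i => F i x) (S x)) :
    eLpNorm S p μ ≤ ∑' i, eLpNorm (F i) p μ := by
  obtain ⟨u, hu⟩ := Filter.exists_seq_tendsto (Filter.atTop : Filter (Finset ι))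
  refine (Lp.eLpNorm_lim_le_liminf_eLpNorm (f := fun m => ∑ i ∈ u m, F i)
    (fun m => Finset.aestronglyMeasurable_sum _ fun i _ => hF i) S ?_).trans ?_
  · filter_upwards [hS] with x hx
    have h := Filter.Tendsto.comp hx hu
    simpa [Function.comp_def, Finset.sum_apply] using h
  · refine (Filter.liminf_le_liminf (v := fun _ => ∑' i, eLpNorm (F i) p μ)
      (Filter.Eventually.of_forall fun m => ?_)).trans (by simp)
    exact (eLpNorm_sum_le (fun i _ => hF i) hp).trans (ENNReal.sum_le_tsum _)

/-! ### The expansion of the normalized kernels -/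

/-- The monomials in the Möbius involutions. -/
def moebiusPow {n : ℕ} (w : Fin n → ℂ) (k : Fin n → ℕ) (z : Fin n → ℂ) : ℂ :=
  ∏ j, moebius (w j) (z j) ^ k j

theorem measurable_moebiusPow {n : ℕ} (w : Fin n → ℂ) (k : Fin n → ℕ) :
    Measurable (moebiusPow w k) := by
  unfold moebiusPow
  refine Finset.measurable_fun_prod _ fun j _ => ?_
  exact ((measurable_moebius (w j)).comp (measurable_pi_apply j)).pow_const _

theorem norm_moebiusPow_le_one {n : ℕ} {w z : Fin n → ℂ} (hw : w ∈ polydisc n)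
    (hz : z ∈ polydisc n) (k : Fin n → ℕ) : ‖moebiusPow w k z‖ ≤ 1 := by
  rw [moebiusPow, norm_prod]
  refine Finset.prod_le_one (fun _ _ => norm_nonneg _) fun j _ => ?_
  rw [norm_pow]
  exact pow_le_one₀ (norm_nonneg _) (norm_moebius_lt_one (hw j) (hz j)).le

/-- The coefficients of the expansion of `∏ⱼ (1 - xⱼ) ^ (αⱼ + 2)`. -/
def multiCoeff {n : ℕ} (α : Fin n → ℝ) (k : Fin n → ℕ) : ℂ := ∏ j, powCoeff (α j + 2) (k j)

theorem one_sub_cpow_mul_discKernel (a : ℝ) {w z v : ℂ} (hw : ‖w‖ < 1) (hz : ‖z‖ < 1)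
    (hv : ‖v‖ < 1) :
    (1 - moebius w z * conj (moebius w v)) ^ ((a + 2 : ℝ) : ℂ) * discKernel a z v =
      (((1 - ‖w‖ ^ 2) ^ (a + 2) : ℝ) : ℂ) * (discKernel a z w * discKernel a w v) := by
  have ne : ∀ {x y : ℂ}, ‖x‖ < 1 → ‖y‖ < 1 → (1 - x * conj y) ^ ((a + 2 : ℝ) : ℂ) ≠ 0 := by
    intro x y hx hy
    simp [Complex.cpow_eq_zero_iff, one_sub_mul_conj_ne_zero hy hx]
  have h := cpow_mul_mul_eq_of_re_pos
    (re_one_sub_pos (norm_mul_conj_lt_one (norm_moebius_lt_one hw hz) (norm_moebius_lt_one hw hv)))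
    (re_one_sub_pos (norm_mul_conj_lt_one hz hw)) (re_one_sub_pos (norm_mul_conj_lt_one hw hv))
    (re_one_sub_pos (norm_mul_conj_lt_one hz hv)) (one_sub_norm_sq_pos hw)
    (one_sub_moebius_mul_conj hw hz hv) ((a + 2 : ℝ) : ℂ)
  rw [← Complex.ofReal_cpow (one_sub_norm_sq_pos hw).le] at h
  have h1 := ne hz hw
  have h2 := ne hw hv
  have h3 := ne hz hv
  rw [discKernel, discKernel, discKernel, mul_one_div, one_div_mul_one_div, mul_one_div,
    div_eq_div_iff h3 (mul_ne_zero h1 h2), ← mul_assoc]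
  exact h

/-- The sum is k_w(z) conj k_w(v). The coefficients do not depend on w, z or v. -/
theorem hasSum_multiCoeff {n : ℕ} {α : Fin n → ℝ} (hα : ∀ j, -1 < α j) :
    (Summable fun k => ‖multiCoeff α k‖) ∧ ∀ w ∈ polydisc n, ∀ z ∈ polydisc n, ∀ v ∈ polydisc n,
      HasSum (fun k => multiCoeff α k * moebiusPow w k z * conj (moebiusPow w k v) * kernel α z v)
        (kernelWeight α w * (kernel α z w * kernel α w v)) := by
  have hpos : ∀ j, 0 < α j + 2 := fun j => by linarith [hα j]
  refine ⟨?_, fun w hw z hz v hv => ?_⟩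
  · have h : ∀ j, Summable fun k => ‖powCoeff (α j + 2) k‖ := fun j =>
      summable_norm_powCoeff (hpos j)
    exact (hasSum_prod_fin h fun j => (h j).of_norm.hasSum).1
  · set x : Fin n → ℂ := fun j => moebius (w j) (z j) * conj (moebius (w j) (v j)) with hx
    have hx1 : ∀ j, ‖x j‖ < 1 := fun j =>
      norm_mul_conj_lt_one (norm_moebius_lt_one (hw j) (hz j)) (norm_moebius_lt_one (hw j) (hv j))
    have h := (hasSum_prod_fin (a := fun j k => powCoeff (α j + 2) k * x j ^ k) (fun j => ?_)
      fun j => hasSum_powCoeff (α j + 2) (hx1 j)).2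
    · have h2 := h.mul_right (kernel α z v)
      have e1 : (∏ j, (1 - x j) ^ ((α j + 2 : ℝ) : ℂ)) * kernel α z v =
          kernelWeight α w * (kernel α z w * kernel α w v) := by
        simp only [kernel_eq_prod, kernelWeight, Complex.ofReal_prod]
        rw [← Finset.prod_mul_distrib, ← Finset.prod_mul_distrib, ← Finset.prod_mul_distrib]
        exact Finset.prod_congr rfl fun j _ =>
          one_sub_cpow_mul_discKernel (α j) (hw j) (hz j) (hv j)
      rw [e1] at h2
      have e2 : (fun k => multiCoeff α k * moebiusPow w k z * conj (moebiusPow w k v) *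
          kernel α z v) = fun k : Fin n → ℕ =>
          (∏ j, powCoeff (α j + 2) (k j) * x j ^ k j) * kernel α z v := by
        funext k
        rw [multiCoeff, moebiusPow, moebiusPow, map_prod, ← Finset.prod_mul_distrib,
          ← Finset.prod_mul_distrib]
        congr 1
        refine Finset.prod_congr rfl fun j _ => ?_
        rw [map_pow, mul_assoc, ← mul_pow]
      rw [e2]
      exact h2
    · refine Summable.of_nonneg_of_le (fun _ => norm_nonneg _) (fun k => ?_)
        (summable_norm_powCoeff (hpos j))
      rw [norm_mul, norm_pow]
      exact mul_le_of_le_one_right (norm_nonneg _) (pow_le_one₀ (norm_nonneg _) (hx1 j).le)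

/-! ### The rank-one estimate -/

theorem integrable_of_memBergman {n : ℕ} {α : Fin n → ℝ} (hα : ∀ j, -1 < α j) {p : ℝ} (hp : 1 ≤ p)
    {f : (Fin n → ℂ) → ℂ} (hf : MemBergman α p f) : Integrable f (weightedMeasure α) := by
  have := isProbabilityMeasure_weightedMeasure hα
  exact hf.2.integrable (by simpa using hp)

/-- Testing `T_f T_ḡ` on the projection of a compactly supported function. -/
theorem toeplitzProduct_bergmanProjection {n : ℕ} {α : Fin n → ℝ} (hα : ∀ j, -1 < α j)
    {f g : (Fin n → ℂ) → ℂ} (hf : DifferentiableOn ℂ f (polydisc n))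
    (hfi : Integrable f (weightedMeasure α)) (hg : DifferentiableOn ℂ g (polydisc n))
    (hgi : Integrable g (weightedMeasure α)) {θ : (Fin n → ℂ) → ℂ} (hθ : Measurable θ)
    (hθg : Measurable fun v => θ v * conj (g v)) {M M' r : ℝ} (hM : 0 ≤ M) (hM' : 0 ≤ M')
    (hθM : ∀ v, ‖θ v‖ ≤ M) (hθgM : ∀ v, ‖θ v * conj (g v)‖ ≤ M') (hr : r < 1)
    (hsupp : ∀ v, r < ‖v‖ → θ v = 0) {z : Fin n → ℂ} (hz : z ∈ polydisc n) :
    toeplitzProduct α f g (bergmanProjection α θ) z =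
      f z * bergmanProjection α (fun v => θ v * conj (g v)) z := by
  have hB := isBoundedHolomorphic_bergmanProjection hα hθg hM' hθgM hr
    fun v hv => by rw [hsupp v hv, zero_mul]
  rw [← toeplitz_eq_mul hα hf hfi hB hz, toeplitzProduct, toeplitz, toeplitz]
  refine congrFun (bergmanProjection_congr hα fun u hu => ?_) z
  have h := toeplitz_conj_bergmanProjection hα hg hgi hθ hM hθM hr hsupp hu
  rw [toeplitz] at h
  rw [h]

/-- The rank-one operator built from the normalized kernels is controlled by `T_f T_ḡ`. -/
theorem exists_bergmanNorm_mul_integral_le {n : ℕ} {α : Fin n → ℝ} (hα : ∀ j, -1 < α j) {p q : ℝ}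
    (hpq : p.HolderConjugate q) : ∃ C : ℝ≥0, ∀ f g : (Fin n → ℂ) → ℂ,
      MemBergman α p f → MemBergman α q g → ∀ c : ℝ≥0,
      IsOperatorBound α p (toeplitzProduct α f g) c → ∀ w ∈ polydisc n,
      ∀ (ψ : (Fin n → ℂ) → ℂ) (M M' r : ℝ), Measurable ψ → (Measurable fun v => ψ v * conj (g v)) →
      (∀ v, ‖ψ v‖ ≤ M) → (∀ v, ‖ψ v * conj (g v)‖ ≤ M') → r < 1 → (∀ v, r < ‖v‖ → ψ v = 0) →
      bergmanNorm α p (fun z => f z * normalizedKernel α w z) *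
        ‖∫ v, ψ v * conj (g v * normalizedKernel α w v) ∂weightedMeasure α‖ₑ ≤
        C * c * bergmanNorm α p ψ := by
  obtain ⟨CP, hCP⟩ := exists_bergmanNorm_bergmanProjection_le hα hpq
  obtain ⟨hsum, hexp⟩ := hasSum_multiCoeff hα
  have hprob := isProbabilityMeasure_weightedMeasure hα
  have hae := ae_weightedMeasure_mem_polydisc hα
  have hp1 : 1 ≤ ENNReal.ofReal p := by simpa using hpq.lt.le
  have hsumE : ∑' k, ‖multiCoeff α k‖ₑ ≠ ∞ := by
    have h := hsum.tsum_ofReal_ne_top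
    simpa only [ofReal_norm] using h
  -- One factor sums the series, the other is the norm bound of the Bergman projection.
  refine ⟨(∑' k, ‖multiCoeff α k‖ₑ).toNNReal * CP, ?_⟩
  intro f g hf hg c hc w hw ψ M M' r hψ hψg hψM hψgM hr hsupp
  have hM : 0 ≤ M := (norm_nonneg _).trans (hψM 0)
  have hM' : 0 ≤ M' := (norm_nonneg _).trans (hψgM 0)
  have hfi := integrable_of_memBergman hα hpq.lt.le hf
  have hgi := integrable_of_memBergman hα hpq.symm.lt.le hg
  set θ : (Fin n → ℕ) → (Fin n → ℂ) → ℂ := fun k v => conj (moebiusPow w k v) * ψ v with hθ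
  have hconj : Measurable (conj : ℂ → ℂ) := Complex.continuous_conj.measurable
  have hφm : ∀ k, Measurable fun v => conj (moebiusPow w k v) := fun k =>
    hconj.comp (measurable_moebiusPow w k)
  -- The monomials are bounded by 1 on the polydisc only; off the ball of radius r the vanishing of
  -- x takes over, so the bound holds everywhere.
  have hφle : ∀ (k : Fin n → ℕ) (v : Fin n → ℂ) (x : ℂ), (r < ‖v‖ → x = 0) →
      ‖conj (moebiusPow w k v) * x‖ ≤ ‖x‖ := by
    intro k v x hx
    rcases lt_or_ge r ‖v‖ with h | h
    · simp [hx h]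
    · rw [norm_mul, Complex.norm_conj]
      exact mul_le_of_le_one_left (norm_nonneg _)
        (norm_moebiusPow_le_one hw (mem_polydisc_of_norm_lt_one (h.trans_lt hr)) k)
  have hθm : ∀ k, Measurable (θ k) := fun k => (hφm k).mul hψ
  have hθψ : ∀ k v, ‖θ k v‖ ≤ ‖ψ v‖ := fun k v => hφle k v (ψ v) (hsupp v)
  have hθg : ∀ k, (fun v => θ k v * conj (g v)) =
      fun v => conj (moebiusPow w k v) * (ψ v * conj (g v)) := fun k => by
    funext v
    simp only [hθ, mul_assoc]
  have hχsupp : ∀ v, r < ‖v‖ → ψ v * conj (g v) = 0 := fun v hv => by rw [hsupp v hv, zero_mul]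
  have hθgm : ∀ k, Measurable fun v => θ k v * conj (g v) := fun k => by
    rw [hθg k]
    exact (hφm k).mul hψg
  have hθgM : ∀ k v, ‖θ k v * conj (g v)‖ ≤ M' := fun k v => by
    rw [congrFun (hθg k) v]
    exact (hφle k v _ (hχsupp v)).trans (hψgM v)
  have hθM : ∀ k v, ‖θ k v‖ ≤ M := fun k v => (hθψ k v).trans (hψM v)
  have hθsupp : ∀ k v, r < ‖v‖ → θ k v = 0 := fun k v hv => by simp [hθ, hsupp v hv]
  set B : (Fin n → ℕ) → (Fin n → ℂ) → ℂ := fun k =>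
    bergmanProjection α fun v => θ k v * conj (g v) with hB
  -- Each f B_k is the Toeplitz product applied to P θ_k, and |θ_k| ≤ |ψ|, so the bound is uniform
  -- in k.
  have hnorm : ∀ k, bergmanNorm α p (fun z => f z * B k z) ≤ c * (CP * bergmanNorm α p ψ) := by
    intro k
    have h1 : bergmanNorm α p (fun z => f z * B k z) =
        bergmanNorm α p (toeplitzProduct α f g (bergmanProjection α (θ k))) := by
      refine eLpNorm_congr_ae ?_
      filter_upwards [hae] with z hz
      rw [toeplitzProduct_bergmanProjection hα hf.1 hfi hg.1 hgi (hθm k) (hθgm k) hM hM' (hθM k)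
        (hθgM k) hr (hθsupp k) hz]
    rw [h1]
    refine (hc _ (isBoundedHolomorphic_bergmanProjection hα (hθm k) hM (hθM k) hr
      (hθsupp k))).2.trans ?_
    gcongr
    refine (hCP _ (hθm k)).trans ?_
    gcongr
    exact eLpNorm_mono (hθψ k)
  set J := ∫ v, ψ v * conj (g v * normalizedKernel α w v) ∂weightedMeasure α with hJ
  -- Pointwise form of the operator expansion: the sum over k and the integral over v are exchanged
  -- by dominated summability.
  have hS : ∀ z ∈ polydisc n, HasSum
      (fun k => multiCoeff α k * moebiusPow w k z * (f z * B k z))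
      (f z * normalizedKernel α w z * J) := by
    intro z hz
    set K := ∏ j, ((1 - r) ^ (α j + 2))⁻¹ with hK
    set F : (Fin n → ℕ) → (Fin n → ℂ) → ℂ := fun k v =>
      multiCoeff α k * moebiusPow w k z * (θ k v * conj (g v) * kernel α z v) with hF
    have hFi : ∀ k, Integrable (F k) (weightedMeasure α) := fun k =>
      (integrable_mul_kernel_of_bounded hα (hθgm k) hM' (hθgM k) hr
        (fun v hv => by rw [hθsupp k v hv, zero_mul]) hz).const_mul _
    have hFle : ∀ k v, ‖F k v‖ ≤ ‖multiCoeff α k‖ * (M' * K) := by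
      intro k v
      rw [hF, norm_mul, norm_mul]
      refine mul_le_mul (mul_le_of_le_one_right (norm_nonneg _)
        (norm_moebiusPow_le_one hw hz k)) ?_ (norm_nonneg _) (norm_nonneg _)
      exact norm_mul_kernel_le hα hM' (hθgM k) hr
        (fun v hv => by rw [hθsupp k v hv, zero_mul]) hz v
    have hFsum : Summable fun k => ∫ v, ‖F k v‖ ∂weightedMeasure α := by
      refine Summable.of_nonneg_of_le (fun k => integral_nonneg fun v => norm_nonneg _)
        (fun k => ?_) (hsum.mul_right (M' * K))
      refine (integral_mono (hFi k).norm (integrable_const _) (hFle k)).trans ?_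
      simp
    have h := hasSum_integral_of_summable_integral_norm hFi hFsum
    have h1 : ∫ v, ∑' k, F k v ∂weightedMeasure α = normalizedKernel α w z * J := by
      rw [hJ, ← integral_const_mul]
      refine integral_congr_ae ?_
      filter_upwards [hae] with v hv
      have h2 := ((hexp w hw z hz v hv).mul_right (ψ v * conj (g v))).tsum_eq
      rw [← normalizedKernel_mul_conj hα hw hv] at h2
      have h3 : ∀ k, F k v = multiCoeff α k * moebiusPow w k z * conj (moebiusPow w k v) *
          kernel α z v * (ψ v * conj (g v)) := fun k => by
        simp only [hF, hθ]
        ring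
      simp only [h3]
      rw [h2, map_mul]
      ring
    rw [h1] at h
    have h4 := h.mul_left (f z)
    rw [← mul_assoc] at h4
    have h5 : (fun k => multiCoeff α k * moebiusPow w k z * (f z * B k z)) =
        fun k => f z * ∫ v, F k v ∂weightedMeasure α := by
      funext k
      have h6 : B k z = ∫ v, θ k v * conj (g v) * kernel α z v ∂weightedMeasure α := rfl
      rw [integral_const_mul, h6]
      ring
    rw [h5]
    exact h4
  have hfinal := eLpNorm_le_tsum_of_hasSum (μ := weightedMeasure α) hp1
    (F := fun k z => multiCoeff α k * moebiusPow w k z * (f z * B k z))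
    (S := fun z => f z * normalizedKernel α w z * J) (fun k => ?_) (hae.mono hS)
  · have h1 : bergmanNorm α p (fun z => f z * normalizedKernel α w z) * ‖J‖ₑ =
        eLpNorm (fun z => f z * normalizedKernel α w z * J) (ENNReal.ofReal p)
          (weightedMeasure α) := by
      have h := eLpNorm_const_smul (p := ENNReal.ofReal p) (μ := weightedMeasure α) J
        fun z => f z * normalizedKernel α w z
      rw [mul_comm, bergmanNorm, ← h]
      congr 1
      funext z
      simp [mul_comm]
    rw [h1]
    refine hfinal.trans ?_
    calc _ ≤ ∑' k, ‖multiCoeff α k‖ₑ * (c * (CP * bergmanNorm α p ψ)) := by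
          refine ENNReal.tsum_le_tsum fun k => ?_
          have h2 : eLpNorm (fun z => multiCoeff α k * moebiusPow w k z * (f z * B k z))
              (ENNReal.ofReal p) (weightedMeasure α) ≤
              eLpNorm (multiCoeff α k • fun z => f z * B k z)
              (ENNReal.ofReal p) (weightedMeasure α) := by
            refine eLpNorm_mono_ae ?_
            filter_upwards [hae] with z hz
            rw [Pi.smul_apply, norm_smul, norm_mul, norm_mul]
            gcongr
            exact mul_le_of_le_one_right (norm_nonneg _) (norm_moebiusPow_le_one hw hz k)
          rw [eLpNorm_const_smul] at h2
          refine h2.trans ?_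
          gcongr
          exact hnorm k
      _ = _ := by
          rw [ENNReal.tsum_mul_right, ENNReal.coe_mul, ENNReal.coe_toNNReal hsumE]
          ring
  · have hBd := (isBoundedHolomorphic_bergmanProjection hα (hθgm k) hM' (hθgM k) hr
      fun v hv => by rw [hθsupp k v hv, zero_mul]).1
    exact (((measurable_moebiusPow w k).aestronglyMeasurable).const_mul _).mul
      (aestronglyMeasurable_of_differentiableOn hα (hf.1.mul hBd))

/-- The rank-one estimate is tested on the function extremal in Hölder's inequality for g k_w.
Truncation to a compact ball keeps that function bounded and the integrals finite. -/
theorem exists_bergmanNorm_mul_indicator_le {n : ℕ} {α : Fin n → ℝ} (hα : ∀ j, -1 < α j) {p q : ℝ}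
    (hpq : p.HolderConjugate q) : ∃ C : ℝ≥0, ∀ f g : (Fin n → ℂ) → ℂ,
      MemBergman α p f → MemBergman α q g → ∀ c : ℝ≥0,
      IsOperatorBound α p (toeplitzProduct α f g) c → ∀ w ∈ polydisc n, ∀ r : ℝ, r < 1 →
      bergmanNorm α p (fun z => f z * normalizedKernel α w z) *
        bergmanNorm α q ((Metric.closedBall 0 r).indicator
          fun z => g z * normalizedKernel α w z) ≤ C * c := by
  obtain ⟨C, hC⟩ := exists_bergmanNorm_mul_integral_le hα hpq
  have hprob := isProbabilityMeasure_weightedMeasure hα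
  have hae := ae_weightedMeasure_mem_polydisc hα
  have hp := hpq.pos
  have hq := hpq.symm.pos
  have hq1 : 0 < q - 1 := by linarith [hpq.symm.lt]
  have hqp : (q - 1) * p = q := hpq.symm.sub_one_mul_conj
  refine ⟨C, fun f g hf hg c hc w hw r hr => ?_⟩
  set E : Set (Fin n → ℂ) := Metric.closedBall 0 r with hE
  have hEm : MeasurableSet E := measurableSet_closedBall
  have hEsub : E ⊆ polydisc n := fun v hv =>
    mem_polydisc_of_norm_lt_one ((mem_closedBall_zero_iff.1 hv).trans_lt hr)
  have hEc : IsCompact E := isCompact_closedBall 0 r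
  have hGd : DifferentiableOn ℂ (fun z => g z * normalizedKernel α w z) (polydisc n) :=
    hg.1.mul (differentiableOn_normalizedKernel α hw)
  set G : (Fin n → ℂ) → ℂ := E.indicator fun z => g z * normalizedKernel α w z with hG
  have hind : ∀ {F : (Fin n → ℂ) → ℂ}, DifferentiableOn ℂ F (polydisc n) →
      Measurable (E.indicator F) ∧ ∃ A : ℝ, ∀ v, ‖E.indicator F v‖ ≤ A := by
    intro F hF
    have hcont := hF.continuousOn.mono hEsub
    constructor
    · classical
      have h := hcont.measurable_piecewise (g := fun _ => (0 : ℂ)) continuousOn_const hEm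
      convert h using 1
      ext z
      simp [Set.indicator, Set.piecewise]
    · obtain ⟨A, hA⟩ := hEc.exists_bound_of_continuousOn hcont
      refine ⟨max A 0, fun v => ?_⟩
      by_cases hv : v ∈ E
      · rw [Set.indicator_of_mem hv]
        exact (hA v hv).trans (le_max_left _ _)
      · rw [Set.indicator_of_notMem hv, norm_zero]
        exact le_max_right _ _
  obtain ⟨hGm, A, hA⟩ := hind hGd
  obtain ⟨hgm, A', hA'⟩ := hind hg.1
  have hA0 : 0 ≤ A := (norm_nonneg _).trans (hA 0)
  -- Then ψ conj G = |G|^q and, since (q - 1)p = q, also |ψ|^p = |G|^q. For q < 2 the power is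
  -- negative, but where G = 0 the second factor makes ψ vanish.
  set ψ : (Fin n → ℂ) → ℂ := fun v => ((‖G v‖ ^ (q - 2) : ℝ) : ℂ) * G v with hψ
  have hGoff : ∀ v, v ∉ E → G v = 0 := fun v hv => Set.indicator_of_notMem hv _
  have hψoff : ∀ v, v ∉ E → ψ v = 0 := fun v hv => by simp [hψ, hGoff v hv]
  have hψnorm : ∀ v, ‖ψ v‖ = ‖G v‖ ^ (q - 1) := by
    intro v
    rw [hψ, norm_mul, Complex.norm_real, Real.norm_of_nonneg (by positivity)]
    rcases eq_or_ne (G v) 0 with h | h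
    · simp [h, Real.zero_rpow hq1.ne']
    · rw [← Real.rpow_add_one (norm_ne_zero_iff.2 h)]
      congr 1
      ring
  have hψm : Measurable ψ := by
    have h1 : Measurable fun v => ((‖G v‖ ^ (q - 2) : ℝ) : ℂ) :=
      Complex.measurable_ofReal.comp (hGm.norm.pow_const _)
    exact h1.mul hGm
  have hψM : ∀ v, ‖ψ v‖ ≤ A ^ (q - 1) := fun v => by
    rw [hψnorm]
    exact Real.rpow_le_rpow (norm_nonneg _) (hA v) hq1.le
  have hψg : ∀ v, ψ v * conj (g v) = ψ v * conj (E.indicator g v) := by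
    intro v
    by_cases hv : v ∈ E
    · rw [Set.indicator_of_mem hv]
    · rw [hψoff v hv, zero_mul, zero_mul]
  have hconj : Measurable (conj : ℂ → ℂ) := Complex.continuous_conj.measurable
  have hψgm : Measurable fun v => ψ v * conj (g v) := by
    simp only [hψg]
    exact hψm.mul (hconj.comp hgm)
  have hψgM : ∀ v, ‖ψ v * conj (g v)‖ ≤ A ^ (q - 1) * A' := fun v => by
    rw [hψg, norm_mul, Complex.norm_conj]
    exact mul_le_mul (hψM v) (hA' v) (norm_nonneg _) (by positivity)
  have hsupp : ∀ v, r < ‖v‖ → ψ v = 0 := fun v hv =>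
    hψoff v fun h => absurd (mem_closedBall_zero_iff.1 h) (not_le.2 hv)
  have key := hC f g hf hg c hc w hw ψ _ _ r hψm hψgm hψM hψgM hr hsupp
  set J : ℝ≥0∞ := ∫⁻ v, ‖G v‖ₑ ^ q ∂weightedMeasure α with hJ
  have hJreal : ∀ v, ‖G v‖ₑ ^ q = ENNReal.ofReal (‖G v‖ ^ q) := fun v => by
    rw [← ofReal_norm, ENNReal.ofReal_rpow_of_nonneg (norm_nonneg _) hq.le]
  have hGi : Integrable (fun v => ‖G v‖ ^ q) (weightedMeasure α) := by
    refine Integrable.of_bound (hGm.norm.pow_const _).aestronglyMeasurable (A ^ q)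
      (Filter.Eventually.of_forall fun v => ?_)
    rw [Real.norm_of_nonneg (by positivity)]
    exact Real.rpow_le_rpow (norm_nonneg _) (hA v) hq.le
  have hJint : J = ENNReal.ofReal (∫ v, ‖G v‖ ^ q ∂weightedMeasure α) := by
    rw [ofReal_integral_eq_lintegral_ofReal hGi
      (Filter.Eventually.of_forall fun v => by positivity), hJ]
    exact lintegral_congr hJreal
  have hJtop : J ≠ ∞ := by
    rw [hJint]
    exact ENNReal.ofReal_ne_top
  have hpair : ‖∫ v, ψ v * conj (g v * normalizedKernel α w v) ∂weightedMeasure α‖ₑ = J := by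
    have h1 : ∀ v, ψ v * conj (g v * normalizedKernel α w v) = ((‖G v‖ ^ q : ℝ) : ℂ) := by
      intro v
      by_cases hv : v ∈ E
      · have h2 : g v * normalizedKernel α w v = G v := by
          rw [hG, Set.indicator_of_mem hv]
        rw [h2, hψ]
        simp only
        rw [mul_assoc, Complex.mul_conj, Complex.normSq_eq_norm_sq, ← Complex.ofReal_mul]
        congr 1
        rcases eq_or_ne (G v) 0 with h | h
        · simp [h, Real.zero_rpow hq.ne']
        · rw [← Real.rpow_two, ← Real.rpow_add (norm_pos_iff.2 h)]
          congr 1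
          ring
      · rw [hψoff v hv, hGoff v hv, zero_mul, norm_zero, Real.zero_rpow hq.ne',
          Complex.ofReal_zero]
    simp only [h1]
    rw [integral_complex_ofReal, hJint, ← ofReal_norm, Complex.norm_real, Real.norm_of_nonneg]
    exact integral_nonneg fun v => by positivity
  have hψp : bergmanNorm α p ψ = J ^ (1 / p) := by
    rw [bergmanNorm, eLpNorm_eq_lintegral_rpow_enorm_toReal (by simpa using hp)
      ENNReal.ofReal_ne_top, ENNReal.toReal_ofReal hp.le, hJ]
    congr 1
    refine lintegral_congr fun v => ?_
    rw [← ofReal_norm, hψnorm, ENNReal.ofReal_rpow_of_nonneg (by positivity) hp.le, hJreal,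
      ← Real.rpow_mul (norm_nonneg _), hqp]
  have hGq : bergmanNorm α q G = J ^ (1 / q) := by
    rw [bergmanNorm, eLpNorm_eq_lintegral_rpow_enorm_toReal (by simpa using hq)
      ENNReal.ofReal_ne_top, ENNReal.toReal_ofReal hq.le]
  rw [hpair, hψp] at key
  rw [hGq]
  rcases eq_or_ne J 0 with h0 | h0
  · rw [h0, ENNReal.zero_rpow_of_pos (by positivity), mul_zero]
    exact zero_le
  have hpos : J ^ (1 / p) ≠ 0 := (ENNReal.rpow_pos (pos_iff_ne_zero.2 h0) hJtop).ne'
  have htop : J ^ (1 / p) ≠ ∞ := ENNReal.rpow_ne_top_of_nonneg (by positivity) hJtop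
  -- The factor J^{1/p} is the norm of ψ; it is finite and nonzero here, so it cancels and leaves
  -- the norm of G.
  have hsplit : J = J ^ (1 / q) * J ^ (1 / p) := by
    rw [← ENNReal.rpow_add _ _ h0 hJtop, one_div, one_div, add_comm, hpq.inv_add_inv_eq_one,
      ENNReal.rpow_one]
  conv_lhs at key => rw [hsplit, ← mul_assoc]
  exact (ENNReal.mul_le_mul_iff_left hpos htop).1 key

end PolydiscBergman

end

/-- If the Toeplitz product `T_f T_{ḡ}` is bounded on the vector weighted Bergman space
`A^p_α(𝔻ⁿ)`, then `[f, g]_{p,α}` is finite and at most a constant, depending only on `n`, `α`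
and `p`, times the norm of the product. -/
theorem mainTheorem6 (n : ℕ) (α : Fin n → ℝ) (hα : ∀ j, -1 < α j)
    (p q : ℝ) (hp : 1 < p) (hpq : p * q = p + q) :
    ∃ C : ℝ≥0, ∀ f g : (Fin n → ℂ) → ℂ,
      PolydiscBergman.MemBergman α p f → PolydiscBergman.MemBergman α q g →
      PolydiscBergman.IsBoundedOperator α p (PolydiscBergman.toeplitzProduct α f g) →
        PolydiscBergman.sarason α p q f g < ∞ ∧
        PolydiscBergman.sarason α p q f g ≤
          C * PolydiscBergman.operatorNorm α p (PolydiscBergman.toeplitzProduct α f g) := by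
  have hconj : p.HolderConjugate q := by
    rw [Real.holderConjugate_iff]
    have hp0 : p ≠ 0 := by linarith
    have hq0 : q ≠ 0 := by
      rintro rfl
      simp at hpq
      linarith
    refine ⟨hp, ?_⟩
    field_simp
    linarith
  obtain ⟨C, hC⟩ := PolydiscBergman.exists_bergmanNorm_mul_indicator_le hα hconj
  have hae := PolydiscBergman.ae_weightedMeasure_mem_polydisc hα
  -- A strictly positive constant can be divided out when passing to the infimum of the bounds.
  refine ⟨C + 1, fun f g hf hg hT => ?_⟩
  have hbound : ∀ c : ℝ≥0,
      PolydiscBergman.IsOperatorBound α p (PolydiscBergman.toeplitzProduct α f g) c →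
      PolydiscBergman.sarason α p q f g ≤ ((C + 1) * c : ℝ≥0) := by
    intro c hc
    refine iSup₂_le fun w hw => ?_
    have hGd := hg.1.mul (PolydiscBergman.differentiableOn_normalizedKernel α hw)
    have hr : ∀ m : ℕ, 1 - 1 / ((m : ℝ) + 1) < 1 := fun m => by
      have : 0 < 1 / ((m : ℝ) + 1) := by positivity
      linarith
    have hm : ∀ m : ℕ, PolydiscBergman.bergmanNorm α p
        (fun z => f z * PolydiscBergman.normalizedKernel α w z) *
        PolydiscBergman.bergmanNorm α q
          ((Metric.closedBall 0 (1 - 1 / ((m : ℝ) + 1))).indicator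
            fun z => g z * PolydiscBergman.normalizedKernel α w z) ≤ ((C + 1) * c : ℝ≥0) := by
      intro m
      refine (hC f g hf hg c hc w hw _ (hr m)).trans ?_
      rw [← ENNReal.coe_mul, ENNReal.coe_le_coe]
      gcongr
      exact le_add_of_nonneg_right zero_le_one
    -- Balls of radius 1 - 1/(m+1) exhaust the polydisc, and Fatou's lemma removes the truncation of
    -- g k_w.
    have hlim := Lp.eLpNorm_lim_le_liminf_eLpNorm (p := ENNReal.ofReal q)
      (μ := PolydiscBergman.weightedMeasure α)
      (f := fun m : ℕ => (Metric.closedBall 0 (1 - 1 / ((m : ℝ) + 1))).indicator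
            fun z => g z * PolydiscBergman.normalizedKernel α w z)
      (fun m => (PolydiscBergman.aestronglyMeasurable_of_differentiableOn hα hGd).indicator
        measurableSet_closedBall) (fun z => g z * PolydiscBergman.normalizedKernel α w z) ?_
    · rcases eq_or_ne (PolydiscBergman.bergmanNorm α p
        (fun z => f z * PolydiscBergman.normalizedKernel α w z)) 0 with h0 | h0
      · rw [h0, zero_mul]
        exact zero_le
      · rw [mul_comm, ← ENNReal.le_div_iff_mul_le (Or.inl h0) (Or.inr ENNReal.coe_ne_top)]
        refine hlim.trans ((Filter.liminf_le_liminf (Filter.Eventually.of_forall fun m => ?_)).trans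
          (Filter.liminf_const _).le)
        rw [ENNReal.le_div_iff_mul_le (Or.inl h0) (Or.inr ENNReal.coe_ne_top), mul_comm]
        exact hm m
    · filter_upwards [hae] with z hz
      refine tendsto_const_nhds.congr' ?_
      have h1 := tendsto_one_div_add_atTop_nhds_zero_nat (𝕜 := ℝ)
      have h2 : 0 < 1 - ‖z‖ := by linarith [PolydiscBergman.norm_lt_one_of_mem_polydisc hz]
      filter_upwards [h1.eventually_lt_const h2] with m hm
      rw [Set.indicator_of_mem]
      rw [mem_closedBall_zero_iff]
      linarith
  obtain ⟨c₀, hc₀⟩ := hT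
  have hfin : PolydiscBergman.sarason α p q f g < ∞ :=
    (hbound c₀ hc₀).trans_lt ENNReal.coe_lt_top
  refine ⟨hfin, ?_⟩
  lift PolydiscBergman.sarason α p q f g to ℝ≥0 using hfin.ne with s
  rw [← ENNReal.coe_mul, ENNReal.coe_le_coe]
  have hC1 : 0 < C + 1 := by positivity
  rw [← div_le_iff₀' hC1]
  -- The estimate holds for every admissible bound c, hence for their infimum; boundedness of the
  -- product makes the set of bounds nonempty.
  refine le_csInf ⟨c₀, hc₀⟩ fun c hc => ?_
  rw [div_le_iff₀' hC1]
  exact_mod_cast hbound c hc
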